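/- Let $d\in\mathbb N$ and let $D=(c_j)_{0\le j\le d}$ be a probability distribution with mean $b=\sum_j j\,c_j>1$. Consider the Galton–Watson process with offspring distribution $D$ on the infinite $d$-ary tree: every node independently draws its number of children from $D$ and connects to a uniformly random set of that many of its $d$ children; the nodes connected to the root are active. The nodes other than the root are the agents; each node has an answer independently with probability $p=1/n$, where $n$ is the rarity. Let $\lambda_i$ be the probability that the first level $i\ge1$ containing an active agent with an answer is level $i$. The direct referral mechanism of height $h\ge 1$ works as follows. Among the answers at levels at most $h$ reported to the root, only those closest to the root are kept, and one of these is selected by the random walk that starts at the root and at each step moves to a uniformly random child having a kept answer in its subtree. If the selected answer is at level $i+s\le h$, the agent at level $i\ge1$ on the path to it receives $r(i,s)$, where $r(i,s)=1$ for $s\ge2$, $r(i,1)=x_i$ with $x_h=0$ and $$x_i=\max_{i+1\le j\le h}\Big\{x_j+\frac{j-i}{\lambda_{i+1}}\sum_{\ell=i+1}^h\lambda_\ell\Big\}\quad(1\le i<h),$$ and $r(i,0)=(h-i+1)+\sum_{j=i}^h x_j$. All other agents receive nothing, and nothing is paid if an agent on the path refuses to forward the selected answer. An agent reached by the query knows its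 level and whether it has an answer, and chooses: a possibly infinite, locally finite rooted tree of identities (itself and its sybils), attached by its root to its parent; the identity to which all its original children are attached; the identities at which its answer, if it has one, is placed; whether to propagate the query; which of the answers it is aware of to report (depending on these answers); and which selected answers to forward. It receives the rewards of all its identities. The mechanism is sybil-proof if the following profile is a Nash equilibrium (no agent can increase its expected reward by a unilateral change of strategy): no agent creates sybils; an agent with an answer reports it and does not propagate the query; an agent without an answer propagates the query if its level is less than $h$, and does not otherwise; all received answers are reported and all selected answers are forwarded. **Theorem.** For every such $D$ there are constants $p_b>0$ and $C$, depending only on $D$, such that for every rarity $n$ with $0<1/n<p_b$ (and $1/n\le 1$) and every $h\ge1$ the direct referral mechanism of height $h$ pays at least $1$ to every agent on a selected answer path, is sybil-proof, and has expected cost (expected total reward paid in the above profile) at most $C h^2$. -/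

import Mathlib

noncomputable section

namespace QueryIncentive

open MeasureTheory ProbabilityTheory
open scoped Classical

/-! ### The network -/

/-- A node of the infinite `d`-ary tree, given by the choices that lead to it from the root, the
last choice first: `[]` is the root and `c :: u` is the `c`-th child of `u`.  The agents are the
nodes other than the root. -/
abbrev Node (d : ℕ) : Type := List (Fin d)

/-- A realization: for every node, the set of children it is connected to, and whether it holds
an answer. -/
abbrev Env (d : ℕ) : Type := Node d → Finset (Fin d) × Bool

/-- The mean number of children. -/
def branchingFactor {d : ℕ} (D : PMF (Fin (d + 1))) : ℝ :=
  ∑ j : Fin (d + 1), (j : ℝ) * (D j).toReal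

lemma powersetCard_nonempty {d : ℕ} (j : Fin (d + 1)) :
    (Finset.powersetCard (j : ℕ) (Finset.univ : Finset (Fin d))).Nonempty := by
  apply Finset.powersetCard_nonempty.2
  simpa using Nat.lt_succ_iff.1 j.2

/-- The law of the set of children: first their number is drawn from `D`, then a set of that size
is drawn uniformly at random. -/
def childLaw {d : ℕ} (D : PMF (Fin (d + 1))) : PMF (Finset (Fin d)) :=
  D.bind fun j => PMF.uniformOfFinset _ (powersetCard_nonempty j)

/-- The law of the network: all nodes draw their children independently, and each node has an
answer independently with probability `p`. -/
def law {d : ℕ} (D : PMF (Fin (d + 1))) (p : unitInterval) : Measure (Env d) :=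
  Measure.infinitePi fun _ : Node d => (childLaw D).toMeasure.prod (bernoulliMeasure true false p)

/-- The node belongs to the connected component of the root. -/
def Active {d : ℕ} (ω : Env d) : Node d → Prop
  | [] => True
  | c :: u => c ∈ (ω u).1 ∧ Active ω u

/-- The probability that no active node of the levels `1, …, i` has an answer. -/
def noAnswerProb {d : ℕ} (D : PMF (Fin (d + 1))) (p : unitInterval) (i : ℕ) : ℝ :=
  (law D p).real {ω | ∀ u : Node d, 1 ≤ u.length → u.length ≤ i → Active ω u → (ω u).2 = false}

/-- The probability that the first answer is at level `i ≥ 1`. -/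
def firstAnswerProb {d : ℕ} (D : PMF (Fin (d + 1))) (p : unitInterval) (i : ℕ) : ℝ :=
  noAnswerProb D p (i - 1) - noAnswerProb D p i

/-! ### Shortest-path answer selection

The root sees a tree of identities and a set of reported answers in it. Identities are
addressed by the steps that lead to them, the last step first. -/

section Selection

variable {α : Type}

/-- The reported answers that are closest to the root. -/
def closest (R : Set (List α)) : Set (List α) :=
  {a | a ∈ R ∧ ∀ b ∈ R, a.length ≤ b.length}

/-- The steps from the identity `b` to those of its children that have an answer of `M` in their
subtree. -/
def liveSteps (M : Set (List α)) (b : List α) : Set α :=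
  {t | ∃ a ∈ M, (t :: b) <:+ a}

/-- The probability that the walk from the root that always moves to a uniformly random child
among those with an answer of `M` in their subtree passes through the given identity. -/
def walkProb (M : Set (List α)) : List α → ℝ
  | [] => 1
  | t :: b => if t ∈ liveSteps M b then walkProb M b / (liveSteps M b).ncard else 0

/-- The expected value of `f` at the selected answer (and `0` if no answer is reported), when `R`
is the set of reported answers: the random walk is performed on the closest answers. -/
def selectionMean (R : Set (List α)) (f : List α → ℝ) : ℝ :=
  ∑ᶠ a ∈ closest R, walkProb (closest R) a * f a

end Selection

/-! ### The game -/

/-- The address of an identity: `Sum.inl c` is the step from an identity of an agent to its real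
child `c`, and `Sum.inr j` is a step from an identity to its `j`-th sybil child. -/
abbrev Addr (d : ℕ) : Type := List (Fin d ⊕ ℕ)

/-- The identities in the locally finite (possibly infinite) rooted tree in which `s` has `kids s`
children; the tree is attached to the parent of the agent by its root `[]`. -/
def InTree (kids : List ℕ → ℕ) : List ℕ → Prop
  | [] => True
  | j :: s => j < kids s ∧ InTree kids s

/-- What an agent decides about a query that has reached it. -/
structure Action (d : ℕ) where
  /-- the number of children of each identity in the tree of identities of the agent -/
  kids : List ℕ → ℕ
  /-- the identity to which the original children are attached -/
  attach : List ℕ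
  attach_mem : InTree kids attach
  /-- the identities at which an answer of its own is placed -/
  place : Set (List ℕ)
  place_sub : ∀ s ∈ place, InTree kids s
  /-- whether the query is propagated to the original children -/
  propagate : Prop
  /-- which of the answers it is aware of the agent reports; only answers that are really there
  count -/
  report : Set (Addr d) → Set (Addr d)
  /-- whether the agent forwards the given answer if it is selected -/
  forward : Addr d → Prop

/-- A strategy of an agent: an action that depends on its level in the tree of identities and on
whether it has an answer. -/
abbrev Strategy (d : ℕ) : Type := ℕ → Bool → Action d

/-- A strategy for every agent. The root is not a player, and its entry is never changed. -/
abbrev Profile (d : ℕ) : Type := Node d → Strategy d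

/-- The action without sybils: with an answer, report it and do not propagate; without an
answer, propagate the query if the level is less than `h`; report and forward everything. -/
def honestAction (d h level : ℕ) (hasAnswer : Bool) : Action d where
  kids := fun _ => 0
  attach := []
  attach_mem := trivial
  place := {[]}
  place_sub := by rintro s rfl; trivial
  propagate := hasAnswer = false ∧ level < h
  report := fun R => R
  forward := fun _ => True

/-- The profile in which nobody creates sybils. -/
def honest (d h : ℕ) : Profile d := fun _ => honestAction d h

section Game

variable {d : ℕ} (σ : Profile d) (ω : Env d)

/-- The address of the first identity of an agent. -/
def position : Node d → Addr d
  | [] => []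
  | c :: u =>
    Sum.inl c :: ((σ u (position u).length (ω u).2).attach.map Sum.inr ++ position u)

/-- The action taken by an agent when the query reaches it. -/
def action (u : Node d) : Action d :=
  σ u (position σ ω u).length (ω u).2

/-- The address of the identity `s` in the tree of identities of the agent `u`. -/
def identity (u : Node d) (s : List ℕ) : Addr d :=
  s.map Sum.inr ++ position σ ω u

/-- The answers that the agent `u`, when the query reaches it, reports to its parent, if the
query is propagated to at most `k` levels of agents, `u` included. -/
def reports : ℕ → Node d → Set (Addr d)
  | 0, _ => ∅
  | k + 1, u =>
    let known : Set (Addr d) :=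
      {a | (ω u).2 = true ∧ ∃ s ∈ (action σ ω u).place, a = identity σ ω u s} ∪
      {a | (action σ ω u).propagate ∧ ∃ c ∈ (ω u).1, a ∈ reports k (c :: u)}
    known ∩ (action σ ω u).report known

/-- The answers that the root receives, except those at levels greater than `h`, which a mechanism
of height `h` ignores. An agent at depth greater than `h` in the tree of agents has all its
identities at levels greater than `h`, so that it is enough to follow the query for `h` levels of
agents. The root always propagates the query. -/
def reported (h : ℕ) : Set (Addr d) :=
  {a | a.length ≤ h ∧ ∃ c ∈ (ω []).1, a ∈ reports σ ω h [c]}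

/-- The agent `u` has an identity on the path from the root to `a`. -/
def OnPath (u : Node d) (a : Addr d) : Prop :=
  ∃ s, identity σ ω u s <:+ a

/-- All agents on the path from the root to the selected answer `a` forward it. -/
def Delivered (a : Addr d) : Prop :=
  ∀ u : Node d, u ≠ [] → OnPath σ ω u a → (action σ ω u).forward a

/-- The total reward of the identities of `u` when the selected answer is `a`. The identity at
level `j` on the path to `a` has the address `a.drop (a.length - j)`, and its reward is
`r j (a.length - j)`. Nothing is paid if some agent on the path does not forward the answer. -/
def payment (r : ℕ → ℕ → ℝ) (u : Node d) (a : Addr d) : ℝ :=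
  if Delivered σ ω a then
    ∑ j ∈ Finset.Icc 1 a.length,
      if ∃ s, a.drop (a.length - j) = identity σ ω u s then r j (a.length - j) else 0
  else 0

/-- The total reward paid by the root when the selected answer is `a`. -/
def totalPayment (r : ℕ → ℕ → ℝ) (a : Addr d) : ℝ :=
  if Delivered σ ω a then ∑ j ∈ Finset.Icc 1 a.length, r j (a.length - j) else 0

end Game

section Mechanism

variable {d : ℕ} (D : PMF (Fin (d + 1))) (p : unitInterval) (h : ℕ) (r : ℕ → ℕ → ℝ)

/-- The expected reward of agent `u` under the profile `σ`, for the mechanism of height `h` with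
shortest-path selection that pays `r i s` to the `i`-th agent of an answer path of length `i + s`. -/
def utility (σ : Profile d) (u : Node d) : ℝ :=
  ∫ ω, selectionMean (reported σ ω h) (payment σ ω r u) ∂(law D p)

/-- No agent can gain by a unilateral change of its strategy. -/
def IsNash (σ : Profile d) : Prop :=
  ∀ u : Node d, u ≠ [] → ∀ τ : Strategy d,
    utility D p h r (Function.update σ u τ) u ≤ utility D p h r σ u

/-- The profile in which nobody creates sybils is a Nash equilibrium. -/
def SybilProof : Prop :=
  IsNash D p h r (honest d h)

/-- The expected total reward paid by the root when nobody creates sybils. -/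
def expectedCost : ℝ :=
  ∫ ω, selectionMean (reported (honest d h) ω h) (totalPayment (honest d h) ω r) ∂(law D p)

end Mechanism

/-! ### The direct referral mechanism -/

/-- A direct referral reward scheme of height `h`: on answer paths of length at most `h` every
reward is at least one, and it is exactly one unless the agent is the answer holder (`s = 0`) or
the parent of the answer holder (`s = 1`). -/
def IsDirectReferral (h : ℕ) (r : ℕ → ℕ → ℝ) : Prop :=
  ∀ i s, 1 ≤ i → i + s ≤ h → 1 ≤ r i s ∧ (2 ≤ s → r i s = 1)

/-- The reward `x i` of the parent, at level `i`, of the answer holder: `0` for `i ≥ h`, and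
otherwise the maximum over `i + 1 ≤ j ≤ h` of
`x j + (j - i) / lam (i + 1) * (lam (i + 1) + … + lam h)`. -/
def referral (lam : ℕ → ℝ) (h i : ℕ) : ℝ :=
  if hi : i < h then
    (Finset.Icc (i + 1) h).attach.sup'
      (Finset.attach_nonempty_iff.2 (Finset.nonempty_Icc.2 hi)) fun j =>
        referral lam h j.1 +
          ((j.1 : ℝ) - i) / lam (i + 1) * ∑ l ∈ Finset.Icc (i + 1) h, lam l
  else 0
termination_by h - i
decreasing_by
  have := Finset.mem_Icc.1 j.2
  omega

/-- The reward of an answer holder at level `i`. -/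
def holderReward (lam : ℕ → ℝ) (h i : ℕ) : ℝ :=
  ((h : ℝ) - i + 1) + ∑ j ∈ Finset.Icc i h, referral lam h j

/-- The rewards of the direct referral mechanism of height `h`. -/
def drReward {d : ℕ} (D : PMF (Fin (d + 1))) (p : unitInterval) (h i s : ℕ) : ℝ :=
  if i + s ≤ h then
    if s = 0 then holderReward (firstAnswerProb D p) h i
    else if s = 1 then referral (firstAnswerProb D p) h i
    else 1
  else 0

end QueryIncentive

end

noncomputable section

namespace QueryIncentive

open MeasureTheory ProbabilityTheory
open scoped Classical


/-! ### Random walks on finite sets of equidistant answers, and their relabellings. -/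

section Selection

variable {α β : Type}

/-! Sybil-proofness. Let the agent `u` at level `i` deviate, and let `l` be the level of the first
true answer. Answers of level `l` outside the subtree of `u` still reach the root at level `l`, and
sybils can only push the answers below `u` further away. So if an answer below `u` is among the
closest ones, the walk passes through `u` at most as often as in the honest profile
(`walkProb_deviation_le`), and it suffices to compare the payments per pass. An agent with an answer
earns at most `r(i,0)` from any chain of identities (`sum_drReward_le_drReward_zero`). An agent
without one that attaches its children `k` sybil steps down earns at most `k + x_{i+k}` if `l =
i+1`, and at most `k + 1` if `l > i+1` (`sum_drReward_sybils_le`). By the symmetry of the tree, the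
honest probability that the first answer is at level `l ≥ i` and the walk passes `u` is `λ_l / d^i`
(`integral_passProb`). Hence sybils do not pay as soon as `λ_{i+1} x_i ≥ λ_{i+1} x_{i+k} + k
(λ_{i+1} + … + λ_h)`, which is the case `j = i+k` of the maximum that defines `x_i`.

Cost. Let `q_m` be the probability of no answer on the levels `1, …, m`. An answer at level `l`
costs at most `h` plus the sum of the `x_j` with `j ≥ max(1, l-1)`, so `x_j` is charged with
probability at most `1 - q_{j+1}`. It remains to see that `x_j (1 - q_{j+1}) ≤ K (h - j)`
(`referral_mul_le`). This follows by induction from `(1 - q_{i+1}) (q_i - q_h) ≤ K λ_{i+1}`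
(`exists_growth_bound`), which is a convexity estimate. With the generating function `f` of `D`,
`q_{m+1} = f((1-p) q_m)` (`noAnswerProb_succ`). Since `b > 1`, some offspring number `≥ 2` has
positive probability, so `t ↦ f((1-p) t)` is strictly convex. It is below the diagonal at `q_h` and
at `1`, hence in between it is below by at least a multiple of `(t - q_h) (1 - t)`. At `t = q_i` the
gap is `λ_{i+1}`. -/

lemma exists_cons_suffix {a b : List α} (hs : b <:+ a) (hl : b.length < a.length) :
    ∃ t, (t :: b) <:+ a := by
  obtain ⟨w, rfl⟩ := hs
  have hw : w ≠ [] := by rintro rfl; simp at hl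
  refine ⟨w.getLast hw, w.dropLast, ?_⟩
  conv_rhs => rw [← List.dropLast_append_getLast hw]
  simp

lemma suffix_of_cons_suffix {a b : List α} {t : α} (hs : (t :: b) <:+ a) : b <:+ a :=
  (List.suffix_cons t b).trans hs

lemma cons_suffix_unique {a b : List α} {t t' : α} (hs : (t :: b) <:+ a) (hs' : (t' :: b) <:+ a) :
    t = t' := by
  have h := (List.suffix_of_suffix_length_le hs hs' (by simp)).eq_of_length (by simp)
  exact (List.cons.inj h).1

lemma finite_liveSteps {M : Set (List α)} (hM : M.Finite) (b : List α) :
    (liveSteps M b).Finite := by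
  have h1 : (⋃ a ∈ M, {s : List α | s ∈ a.tails}).Finite :=
    hM.biUnion fun a _ => List.finite_toSet _
  refine Set.Finite.of_finite_image (f := fun t => t :: b) (h1.subset ?_) ?_
  · rintro _ ⟨t, ⟨a, ha, hs⟩, rfl⟩
    simp only [Set.mem_iUnion, Set.mem_ofPred_eq, List.mem_tails]
    exact ⟨a, ha, hs⟩
  · intro t _ t' _ h
    exact (List.cons.inj h).1

lemma walkProb_nonneg (M : Set (List α)) (b : List α) : 0 ≤ walkProb M b := by
  induction b with
  | nil => simp [walkProb]
  | cons t b ih =>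
    rw [walkProb]
    split_ifs
    · positivity
    · exact le_rfl

lemma walkProb_eq_zero {M : Set (List α)} {b : List α} (hb : b ≠ []) (h : ¬ ∃ a ∈ M, b <:+ a) :
    walkProb M b = 0 := by
  cases b with
  | nil => exact absurd rfl hb
  | cons t b => rw [walkProb, if_neg (by exact h)]

/-- The walk ends at one of the answers below an identity with the probability that it passes
through that identity. -/
lemma sum_walkProb {M : Set (List α)} (hM : M.Finite) {l : ℕ} (hl : ∀ a ∈ M, a.length = l)
    (b : List α) (hb : ∃ a ∈ M, b <:+ a) :
    ∑ a ∈ hM.toFinset with b <:+ a, walkProb M a = walkProb M b := by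
  -- Induction on the distance from `b` to the answers: those below `b` are partitioned by the next
  -- live step, and the live steps share `walkProb M b` equally.
  obtain ⟨n, hn⟩ : ∃ n, n = l - b.length := ⟨_, rfl⟩
  induction n generalizing b with
  | zero =>
    have h1 : ∀ a ∈ M, b <:+ a → a = b := fun a ha hs =>
      (hs.eq_of_length_le (by have := hl a ha; omega)).symm
    obtain ⟨a, ha, hs⟩ := hb
    have hbM : b ∈ M := h1 a ha hs ▸ ha
    rw [Finset.sum_eq_single b]
    · intro a ha hne
      simp only [Finset.mem_filter, Set.Finite.mem_toFinset] at ha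
      exact absurd (h1 a ha.1 ha.2) hne
    · intro h
      simp [hbM] at h
  | succ n ih =>
    have hf := finite_liveSteps hM b
    have hlt : ∀ a ∈ M, b.length < a.length := fun a ha => by rw [hl a ha]; omega
    have hsplit : hM.toFinset.filter (fun a => b <:+ a) =
        hf.toFinset.biUnion fun t => hM.toFinset.filter fun a => (t :: b) <:+ a := by
      ext a
      simp only [Finset.mem_filter, Set.Finite.mem_toFinset, Finset.mem_biUnion]
      constructor
      · rintro ⟨ha, hs⟩
        obtain ⟨t, ht⟩ := exists_cons_suffix hs (hlt a ha)
        exact ⟨t, ⟨a, ha, ht⟩, ha, ht⟩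
      · rintro ⟨t, _, ha, hs⟩
        exact ⟨ha, suffix_of_cons_suffix hs⟩
    rw [hsplit, Finset.sum_biUnion]
    · have h2 : ∀ t ∈ hf.toFinset, ∑ a ∈ hM.toFinset with (t :: b) <:+ a, walkProb M a
          = walkProb M b / (liveSteps M b).ncard := by
        intro t ht
        rw [Set.Finite.mem_toFinset] at ht
        rw [ih (t :: b) ht (by simp; omega), walkProb, if_pos ht]
      rw [Finset.sum_congr rfl h2, Finset.sum_const, ← Set.ncard_eq_toFinset_card _ hf,
        nsmul_eq_mul]
      obtain ⟨a, ha, hs⟩ := hb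
      obtain ⟨t, ht⟩ := exists_cons_suffix hs (hlt a ha)
      have hne : (liveSteps M b).ncard ≠ 0 := by
        rw [Ne, Set.ncard_eq_zero hf]
        exact Set.Nonempty.ne_empty ⟨t, a, ha, ht⟩
      field_simp
    · intro t _ t' _ hne
      rw [Function.onFun, Finset.disjoint_left]
      intro a ha ha'
      simp only [Finset.mem_filter] at ha ha'
      exact hne (cons_suffix_unique ha.2 ha'.2)

/-- An identity is visited less often if answers are added outside its subtree. -/
lemma walkProb_le_walkProb {M N : Set (List α)} (hM : M.Finite) (b : List α)
    (h : ∀ a ∈ N, b <:+ a ∨ a ∈ M) (hbM : ∃ a ∈ M, b <:+ a) (hbN : ∃ a ∈ N, b <:+ a) :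
    walkProb M b ≤ walkProb N b := by
  induction b with
  | nil => simp [walkProb]
  | cons t b ih =>
    -- At each identity on the way, the answers of `N` that need not belong to `M` can only make the
    -- step `t` live, and `t` is live for `M` anyway. So the walk on `N` has no more choices.
    have hsub : liveSteps N b ⊆ liveSteps M b := by
      rintro t' ⟨a, ha, hs⟩
      rcases h a ha with h1 | h1
      · rw [cons_suffix_unique hs h1]
        exact hbM
      · exact ⟨a, h1, hs⟩
    have hfM := finite_liveSteps hM b
    have hpos : 0 < (liveSteps N b).ncard :=
      (Set.ncard_pos (hfM.subset hsub)).2 ⟨t, hbN⟩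
    rw [walkProb, walkProb, if_pos (by exact hbM), if_pos (by exact hbN)]
    have hcard := Set.ncard_le_ncard hsub hfM
    have := ih (fun a ha => (h a ha).imp_left suffix_of_cons_suffix)
      (hbM.imp fun a ha => ⟨ha.1, suffix_of_cons_suffix ha.2⟩)
      (hbN.imp fun a ha => ⟨ha.1, suffix_of_cons_suffix ha.2⟩)
    exact div_le_div₀ (walkProb_nonneg _ _) this (by exact_mod_cast hpos) (by exact_mod_cast hcard)

/-- A relabelling acts step by step, with a map `g u` for the steps made at `u`. It is used both for
the inclusion `List.map Sum.inl` of agents into addresses and for the tree automorphisms `permNode`.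
-/
lemma suffix_relabel {φ : List α → List β} {g : List α → α → β}
    (h1 : ∀ c u, φ (c :: u) = g u c :: φ u) {a b : List α} (hs : b <:+ a) : φ b <:+ φ a := by
  induction a with
  | nil => rw [List.suffix_nil.1 hs]
  | cons c a ih =>
    rcases List.suffix_cons_iff.1 hs with rfl | h
    · exact List.suffix_refl _
    · rw [h1]
      exact (ih h).trans (List.suffix_cons _ _)

lemma exists_of_suffix_relabel {φ : List α → List β} {g : List α → α → β} (h0 : φ [] = [])
    (h1 : ∀ c u, φ (c :: u) = g u c :: φ u) {a : List α} {b : List β} (hs : b <:+ φ a) :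
    ∃ s, s <:+ a ∧ φ s = b := by
  induction a with
  | nil =>
    rw [h0, List.suffix_nil] at hs
    exact ⟨[], List.suffix_refl _, by rw [h0, hs]⟩
  | cons c a ih =>
    rw [h1] at hs
    rcases List.suffix_cons_iff.1 hs with rfl | h
    · exact ⟨c :: a, List.suffix_refl _, h1 c a⟩
    · obtain ⟨s, hs', rfl⟩ := ih h
      exact ⟨s, hs'.trans (List.suffix_cons _ _), rfl⟩

lemma relabel_injective {φ : List α → List β} {g : List α → α → β} (h0 : φ [] = [])
    (h1 : ∀ c u, φ (c :: u) = g u c :: φ u) (hg : ∀ u, Function.Injective (g u)) :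
    Function.Injective φ := by
  intro a
  induction a with
  | nil =>
    intro b hb
    cases b with
    | nil => rfl
    | cons c b => rw [h0, h1] at hb; cases hb
  | cons c a ih =>
    intro b hb
    cases b with
    | nil => rw [h0, h1] at hb; cases hb
    | cons c' b =>
      rw [h1, h1] at hb
      obtain ⟨h2, h3⟩ := List.cons.inj hb
      obtain rfl := ih h3
      rw [hg _ h2]

lemma suffix_relabel_iff {φ : List α → List β} {g : List α → α → β} (h0 : φ [] = [])
    (h1 : ∀ c u, φ (c :: u) = g u c :: φ u) (hg : ∀ u, Function.Injective (g u))
    {a b : List α} : φ b <:+ φ a ↔ b <:+ a := by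
  refine ⟨fun hs => ?_, suffix_relabel h1⟩
  obtain ⟨s, hs', h⟩ := exists_of_suffix_relabel h0 h1 hs
  rwa [← relabel_injective h0 h1 hg h]

/-- The walk is not affected by an injective relabelling of the steps, which may depend on the
identity at which the step is made. -/
lemma walkProb_relabel {φ : List α → List β} {g : List α → α → β} (h0 : φ [] = [])
    (h1 : ∀ c u, φ (c :: u) = g u c :: φ u) (hg : ∀ u, Function.Injective (g u))
    (M : Set (List α)) (b : List α) : walkProb (φ '' M) (φ b) = walkProb M b := by
  have hlive : ∀ b, liveSteps (φ '' M) (φ b) = g b '' liveSteps M b := by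
    intro b
    ext t'
    constructor
    · rintro ⟨_, ⟨a, ha, rfl⟩, hs⟩
      obtain ⟨s, hs', h⟩ := exists_of_suffix_relabel h0 h1 hs
      cases s with
      | nil => rw [h0] at h; cases h
      | cons t s =>
        rw [h1] at h
        obtain ⟨h2, h3⟩ := List.cons.inj h
        obtain rfl := relabel_injective h0 h1 hg h3
        exact ⟨t, ⟨a, ha, hs'⟩, h2⟩
    · rintro ⟨t, ⟨a, ha, hs⟩, rfl⟩
      refine ⟨φ a, ⟨a, ha, rfl⟩, ?_⟩
      rw [← h1]
      exact suffix_relabel h1 hs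
  induction b with
  | nil => rw [h0]; simp [walkProb]
  | cons t b ih =>
    rw [h1, walkProb, walkProb, hlive, (hg b).mem_set_image, ih,
      Set.ncard_image_of_injective _ (hg b)]

lemma selectionMean_eq_sum {R : Set (List α)} (hR : (closest R).Finite) (f : List α → ℝ) :
    selectionMean R f = ∑ a ∈ hR.toFinset, walkProb (closest R) a * f a := by
  rw [selectionMean]
  exact finsum_mem_eq_finite_toFinset_sum _ hR

lemma length_eq_of_mem_closest {R : Set (List α)} {a b : List α} (ha : a ∈ closest R)
    (hb : b ∈ closest R) : a.length = b.length :=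
  le_antisymm (ha.2 b hb.1) (hb.2 a ha.1)

lemma selectionMean_eq_zero {R : Set (List α)} {f : List α → ℝ} (hf : ∀ a ∈ closest R, f a = 0) :
    selectionMean R f = 0 := by
  rw [selectionMean]
  exact finsum_mem_of_eqOn_zero fun a ha => by simp [hf a ha]

/-- A payoff that is obtained only if the walk passes through `b`, and is bounded by `B`. -/
lemma selectionMean_le {R : Set (List α)} (hR : (closest R).Finite) {f : List α → ℝ}
    (b : List α) (hb : ∃ a ∈ closest R, b <:+ a) {B : ℝ}
    (hf : ∀ a ∈ closest R, b <:+ a → f a ≤ B) (hf' : ∀ a ∈ closest R, ¬ b <:+ a → f a = 0) :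
    selectionMean R f ≤ walkProb (closest R) b * B := by
  obtain ⟨a₀, ha₀, _⟩ := id hb
  rw [selectionMean_eq_sum hR,
    ← sum_walkProb hR (fun a ha => length_eq_of_mem_closest ha ha₀) b hb, Finset.sum_mul,
    Finset.sum_filter]
  refine Finset.sum_le_sum fun a ha => ?_
  rw [Set.Finite.mem_toFinset] at ha
  split_ifs with h
  · exact mul_le_mul_of_nonneg_left (hf a ha h) (walkProb_nonneg _ _)
  · rw [hf' a ha h, mul_zero]

lemma selectionMean_eq {R : Set (List α)} (hR : (closest R).Finite) {f : List α → ℝ}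
    (b : List α) (hb : ∃ a ∈ closest R, b <:+ a) {B : ℝ}
    (hf : ∀ a ∈ closest R, b <:+ a → f a = B) (hf' : ∀ a ∈ closest R, ¬ b <:+ a → f a = 0) :
    selectionMean R f = walkProb (closest R) b * B := by
  obtain ⟨a₀, ha₀, _⟩ := id hb
  rw [selectionMean_eq_sum hR,
    ← sum_walkProb hR (fun a ha => length_eq_of_mem_closest ha ha₀) b hb, Finset.sum_mul,
    Finset.sum_filter]
  refine Finset.sum_congr rfl fun a ha => ?_
  rw [Set.Finite.mem_toFinset] at ha
  split_ifs with h
  · rw [hf a ha h]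
  · rw [hf' a ha h, mul_zero]

/-- Exactly one of the identities at a given distance from the root is visited. -/
lemma sum_walkProb_level {M : Set (List α)} (hM : M.Finite) (hne : M.Nonempty) {l : ℕ}
    (hl : ∀ a ∈ M, a.length = l) {i : ℕ} (hi : i ≤ l) (S : Finset (List α))
    (hS : ∀ b, b ∈ S ↔ b.length = i) : ∑ b ∈ S, walkProb M b = 1 := by
  have h1 : ∀ b ∈ S, walkProb M b = ∑ a ∈ hM.toFinset with b <:+ a, walkProb M a := by
    intro b hb
    by_cases h : ∃ a ∈ M, b <:+ a
    · exact (sum_walkProb hM hl b h).symm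
    · rw [walkProb_eq_zero _ h, Finset.filter_eq_empty_iff.2, Finset.sum_empty]
      · intro a ha hs
        exact h ⟨a, hM.mem_toFinset.1 ha, hs⟩
      · rintro rfl
        obtain ⟨a, ha⟩ := hne
        exact h ⟨a, ha, List.nil_suffix⟩
  have h2 := sum_walkProb hM hl [] (hne.imp fun a ha => ⟨ha, List.nil_suffix⟩)
  rw [Finset.filter_true_of_mem fun a _ => List.nil_suffix] at h2
  rw [Finset.sum_congr rfl h1]
  simp_rw [Finset.sum_filter]
  rw [Finset.sum_comm, ← show walkProb M [] = 1 from rfl, ← h2]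
  refine Finset.sum_congr rfl fun a ha => ?_
  have hla := hl a (hM.mem_toFinset.1 ha)
  rw [Finset.sum_eq_single (a.drop (a.length - i)), if_pos (List.drop_suffix _ _)]
  · intro b hb hne
    refine if_neg fun hs => hne ?_
    refine (List.suffix_of_suffix_length_le hs (List.drop_suffix _ _) ?_).eq_of_length ?_ <;>
    · simp only [List.length_drop, (hS b).1 hb]
      omega
  · intro h
    exact absurd ((hS _).2 (by rw [List.length_drop]; omega)) h

end Selection

/-! ### Reported answers and payments when agents are honest. -/

section Game

variable {d : ℕ}

/-- The active agents of level `l` that have an answer. -/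
def answersAt (ω : Env d) (l : ℕ) : Set (Node d) :=
  {v | v.length = l ∧ Active ω v ∧ (ω v).2 = true}

/-- The first level `≥ 1` with an active agent that has an answer is level `l`. -/
def FirstAt (ω : Env d) (l : ℕ) : Prop :=
  (∀ m, 1 ≤ m → m < l → answersAt ω m = ∅) ∧ (answersAt ω l).Nonempty

/-- The probability that the first answer is at level `l` and the walk to it passes
through `u`, given the realization. -/
def passProb (ω : Env d) (u : Node d) (l : ℕ) : ℝ :=
  if FirstAt ω l then walkProb (answersAt ω l) u else 0

lemma passProb_nonneg (ω : Env d) (u : Node d) (l : ℕ) : 0 ≤ passProb ω u l := by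
  rw [passProb]
  split_ifs
  · exact walkProb_nonneg _ _
  · exact le_rfl

lemma FirstAt.le {ω : Env d} {l m : ℕ} (h : FirstAt ω l) (hm : 1 ≤ m)
    (hne : (answersAt ω m).Nonempty) : l ≤ m := by
  by_contra hlt
  exact hne.ne_empty (h.1 m hm (not_le.1 hlt))

lemma FirstAt.unique {ω : Env d} {l m : ℕ} (h : FirstAt ω l) (h' : FirstAt ω m) (hl : 1 ≤ l)
    (hm : 1 ≤ m) : l = m :=
  le_antisymm (h.le hm h'.2) (h'.le hl h.2)

lemma exists_firstAt {ω : Env d} {m : ℕ} (hm : 1 ≤ m) (hne : (answersAt ω m).Nonempty) :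
    ∃ l, 1 ≤ l ∧ l ≤ m ∧ FirstAt ω l := by
  have hex : ∃ l, 1 ≤ l ∧ (answersAt ω l).Nonempty := ⟨m, hm, hne⟩
  refine ⟨Nat.find hex, (Nat.find_spec hex).1, Nat.find_min' hex ⟨hm, hne⟩, fun l hl hlt => ?_,
    (Nat.find_spec hex).2⟩
  by_contra h
  exact Nat.find_min hex hlt ⟨hl, Set.nonempty_iff_ne_empty.2 h⟩

lemma Active.of_suffix {ω : Env d} {v w : Node d} (hv : Active ω v) (hs : w <:+ v) :
    Active ω w := by
  induction v with
  | nil => rwa [List.suffix_nil.1 hs]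
  | cons c v ih =>
    rcases List.suffix_cons_iff.1 hs with rfl | h
    · exact hv
    · exact ih hv.2 h

lemma finite_answersAt (ω : Env d) (l : ℕ) : (answersAt ω l).Finite :=
  (List.finite_length_eq (Fin d) l).subset fun _ h => h.1

lemma length_le_length_position (σ : Profile d) (ω : Env d) (v : Node d) :
    v.length ≤ (position σ ω v).length := by
  induction v with
  | nil => simp
  | cons c v ih =>
    rw [position]
    simp only [List.length_cons, List.length_append]
    omega

lemma mem_reports {σ : Profile d} {ω : Env d} {k : ℕ} {v : Node d} {a : Addr d}
    (ha : a ∈ reports σ ω k v) (hv : Active ω v) :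
    ∃ v', v <:+ v' ∧ Active ω v' ∧ (ω v').2 = true ∧
      ∃ s ∈ (action σ ω v').place, a = identity σ ω v' s := by
  induction k generalizing v with
  | zero => exact absurd ha (Set.notMem_empty a)
  | succ k ih =>
    rcases ha.1 with h | ⟨_, c, hc, hr⟩
    · exact ⟨v, List.suffix_refl _, hv, h⟩
    · obtain ⟨v', hs, h⟩ := ih hr ⟨hc, hv⟩
      exact ⟨v', suffix_of_cons_suffix hs, h⟩

lemma mem_reported {σ : Profile d} {ω : Env d} {h : ℕ} {a : Addr d} (ha : a ∈ reported σ ω h) :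
    ∃ v, v ≠ [] ∧ Active ω v ∧ (ω v).2 = true ∧
      ∃ s ∈ (action σ ω v).place, a = identity σ ω v s := by
  obtain ⟨_, c, hc, hr⟩ := ha
  obtain ⟨v, hs, h⟩ := mem_reports hr ⟨hc, trivial⟩
  refine ⟨v, ?_, h⟩
  rintro rfl
  simpa using hs.length_le

lemma finite_inTree (kids : List ℕ → ℕ) (n : ℕ) : {s | InTree kids s ∧ s.length ≤ n}.Finite := by
  induction n with
  | zero =>
    refine (Set.finite_singleton []).subset ?_
    rintro s ⟨_, hs⟩
    simpa using hs
  | succ n ih =>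
    refine ((Set.finite_singleton []).union
      (ih.biUnion fun s _ => (Set.finite_lt_nat (kids s)).image fun j => j :: s)).subset ?_
    rintro s ⟨hs, hl⟩
    cases s with
    | nil => exact Or.inl rfl
    | cons j s =>
      refine Or.inr (Set.mem_biUnion (x := s) ⟨hs.2, ?_⟩ ⟨j, hs.1, rfl⟩)
      simpa using hl

/-- Sybil trees may be infinite, but addresses are cut at length `h`: only agents of depth at most
`h` matter, as sybils never shorten an address, and local finiteness leaves finitely many identities
for each of them. -/
lemma finite_reported (σ : Profile d) (ω : Env d) (h : ℕ) : (reported σ ω h).Finite := by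
  refine ((List.finite_length_le (Fin d) h).biUnion fun v _ =>
    (finite_inTree (action σ ω v).kids h).image (identity σ ω v)).subset fun a ha => ?_
  obtain ⟨v, _, _, _, s, hs, rfl⟩ := mem_reported ha
  have hl : (identity σ ω v s).length ≤ h := ha.1
  rw [identity, List.length_append, List.length_map] at hl
  have := length_le_length_position σ ω v
  exact Set.mem_biUnion (x := v) (show v.length ≤ h by omega)
    ⟨s, ⟨(action σ ω v).place_sub s hs, by omega⟩, rfl⟩

lemma finite_closest (σ : Profile d) (ω : Env d) (h : ℕ) : (closest (reported σ ω h)).Finite :=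
  (finite_reported σ ω h).subset fun _ ha => ha.1

lemma map_inl_suffix_iff {v w : Node d} :
    (w.map Sum.inl : Addr d) <:+ v.map Sum.inl ↔ w <:+ v :=
  suffix_relabel_iff (φ := List.map Sum.inl) (g := fun _ => Sum.inl) rfl (fun _ _ => rfl)
    fun _ => Sum.inl_injective

lemma walkProb_map_inl (M : Set (Node d)) (u : Node d) :
    walkProb ((List.map Sum.inl : Node d → Addr d) '' M) (u.map Sum.inl) = walkProb M u :=
  walkProb_relabel (φ := List.map Sum.inl) (g := fun _ => Sum.inl) rfl (fun _ _ => rfl)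
    (fun _ => Sum.inl_injective) M u

lemma position_eq_map {σ : Profile d} {h : ℕ} (ω : Env d) {v : Node d}
    (hσ : ∀ w, w <:+ v → w ≠ v → σ w = honestAction d h) :
    position σ ω v = v.map Sum.inl := by
  induction v with
  | nil => rfl
  | cons c v ih =>
    have hv : v ≠ c :: v := fun h => by simpa using congrArg List.length h
    rw [position, hσ v (List.suffix_cons c v) hv, ih]
    · rfl
    · intro w hs hne
      refine hσ w (hs.trans (List.suffix_cons c v)) ?_
      rintro rfl
      simpa using hs.length_le

/-- An answer is reported if its holder and the agents above it are honest, and the latter have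
no answers. -/
lemma map_mem_reported {σ : Profile d} {ω : Env d} {h : ℕ} {v : Node d}
    (hσ : ∀ w, w <:+ v → σ w = honestAction d h) (hne : v ≠ []) (hl : v.length ≤ h)
    (hv : Active ω v) (ha : (ω v).2 = true)
    (hna : ∀ w, w <:+ v → w ≠ v → w ≠ [] → (ω w).2 = false) :
    v.map Sum.inl ∈ reported σ ω h := by
  have hpos : ∀ w, w <:+ v → position σ ω w = w.map Sum.inl := fun w hw =>
    position_eq_map ω fun w' hw' _ => hσ w' (hw'.trans hw)
  -- The answer climbs from its holder `v` to the ancestor `w`, `n` levels above; the cutoff `k` has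
  -- to exceed `n` because it counts `w` as well.
  have key : ∀ n w, w <:+ v → w ≠ [] → v.length - w.length = n → ∀ k, n < k →
      v.map Sum.inl ∈ reports σ ω k w := by
    intro n
    induction n with
    | zero =>
      intro w hw _ hn k hk
      obtain rfl := hw.eq_of_length_le (by omega)
      obtain ⟨k, rfl⟩ := Nat.exists_eq_succ_of_ne_zero hk.ne'
      have hact : action σ ω w = honestAction d h (position σ ω w).length (ω w).2 := by
        rw [action, hσ w hw]
      rw [reports, hact]
      have hmem : w.map Sum.inl ∈ {a | (ω w).2 = true ∧
          ∃ s ∈ (honestAction d h (position σ ω w).length (ω w).2).place,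
            a = identity σ ω w s} :=
        ⟨ha, [], rfl, by rw [identity, hpos w hw]; rfl⟩
      exact ⟨Or.inl hmem, Or.inl hmem⟩
    | succ n ih =>
      intro w hw hw0 hn k hk
      obtain ⟨c, hc⟩ := exists_cons_suffix hw (by omega)
      obtain ⟨k, rfl⟩ := Nat.exists_eq_succ_of_ne_zero (by omega : k ≠ 0)
      have hact : action σ ω w = honestAction d h (position σ ω w).length (ω w).2 := by
        rw [action, hσ w hw]
      have hwv : w ≠ v := by rintro rfl; omega
      rw [reports, hact]
      have hmem : v.map Sum.inl ∈ {a |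
          (honestAction d h (position σ ω w).length (ω w).2).propagate ∧
            ∃ c ∈ (ω w).1, a ∈ reports σ ω k (c :: w)} := by
        refine ⟨⟨hna w hw hwv hw0, ?_⟩, c, (hv.of_suffix hc).1,
          ih (c :: w) hc (List.cons_ne_nil _ _) (by simp; omega) k (by omega)⟩
        rw [hpos w hw, List.length_map]
        omega
      exact ⟨Or.inr hmem, Or.inr hmem⟩
  obtain ⟨c, hc⟩ := exists_cons_suffix (b := []) (a := v) List.nil_suffix
    (List.length_pos_iff.2 hne)
  refine ⟨by simpa using hl, c, (hv.of_suffix hc).1, ?_⟩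
  have := hc.length_le
  simp only [List.length_cons, List.length_nil] at this
  exact key _ [c] hc (List.cons_ne_nil _ _) rfl h (by simp; omega)

/-- Agents strictly above a first answer have no answers, so they all propagate. Honesty is needed
only on the path to `v`, so this also covers answers outside the subtree of a deviating agent. -/
lemma map_mem_reported_of_firstAt {σ : Profile d} {ω : Env d} {h l : ℕ} {v : Node d}
    (hσ : ∀ w, w <:+ v → σ w = honestAction d h) (hL : FirstAt ω l) (h1 : 1 ≤ l) (hl : l ≤ h)
    (hv : v ∈ answersAt ω l) : v.map Sum.inl ∈ reported σ ω h := by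
  obtain ⟨rfl, hact, ha⟩ := hv
  refine map_mem_reported hσ (List.length_pos_iff.1 h1) hl hact ha fun w hw hne h0 => ?_
  by_contra hb
  have hlt : w.length < v.length := lt_of_le_of_ne hw.length_le fun h => hne (hw.eq_of_length h)
  have : w ∈ answersAt ω w.length := ⟨rfl, hact.of_suffix hw, by simpa using hb⟩
  rw [hL.1 _ (List.length_pos_iff.2 h0) hlt] at this
  exact this

/-! ### The profile without sybils -/

lemma position_honest (h : ℕ) (ω : Env d) (v : Node d) :
    position (honest d h) ω v = v.map Sum.inl :=
  position_eq_map (h := h) ω fun _ _ _ => rfl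

lemma delivered_honest (h : ℕ) (ω : Env d) (a : Addr d) : Delivered (honest d h) ω a :=
  fun _ _ _ => trivial

lemma mem_reported_honest {h : ℕ} {ω : Env d} {a : Addr d}
    (ha : a ∈ reported (honest d h) ω h) :
    ∃ v, 1 ≤ v.length ∧ v.length ≤ h ∧ v ∈ answersAt ω v.length ∧ a = v.map Sum.inl := by
  obtain ⟨v, hne, hv, hans, s, hs, rfl⟩ := mem_reported ha
  obtain rfl : s = [] := hs
  have hid : identity (honest d h) ω v [] = v.map Sum.inl := by
    rw [identity, position_honest]
    rfl
  rw [hid]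
  refine ⟨v, List.length_pos_iff.2 hne, ?_, ⟨rfl, hv, hans⟩, rfl⟩
  have := ha.1
  rwa [hid, List.length_map] at this

lemma closest_honest {h l : ℕ} {ω : Env d} (hL : FirstAt ω l) (h1 : 1 ≤ l) (hl : l ≤ h) :
    closest (reported (honest d h) ω h) = List.map Sum.inl '' answersAt ω l := by
  have hsub : ∀ v ∈ answersAt ω l, v.map Sum.inl ∈ reported (honest d h) ω h := fun v hv =>
    map_mem_reported_of_firstAt (fun _ _ => rfl) hL h1 hl hv
  have hmin : ∀ a ∈ reported (honest d h) ω h, l ≤ a.length := by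
    intro a ha
    obtain ⟨v, hv1, _, hv, rfl⟩ := mem_reported_honest ha
    rw [List.length_map]
    exact hL.le hv1 ⟨v, hv⟩
  ext a
  constructor
  · rintro ⟨ha, hmin'⟩
    obtain ⟨v, hv1, _, hv, rfl⟩ := mem_reported_honest ha
    refine ⟨v, ?_, rfl⟩
    obtain ⟨v₀, hv₀⟩ := hL.2
    have h2 := hmin' _ (hsub v₀ hv₀)
    have h3 := hmin _ ha
    rw [List.length_map, List.length_map, hv₀.1] at h2
    rw [List.length_map] at h3
    rwa [le_antisymm h2 h3] at hv
  · rintro ⟨v, hv, rfl⟩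
    refine ⟨hsub v hv, fun b hb => ?_⟩
    rw [List.length_map, hv.1]
    exact hmin b hb

lemma closest_honest_eq_empty {h : ℕ} {ω : Env d}
    (hL : ∀ l, 1 ≤ l → l ≤ h → ¬ FirstAt ω l) : closest (reported (honest d h) ω h) = ∅ := by
  refine Set.eq_empty_of_forall_notMem fun a ha => ?_
  obtain ⟨v, hv1, hvh, hv, rfl⟩ := mem_reported_honest ha.1
  obtain ⟨l, hl1, hl, hF⟩ := exists_firstAt hv1 ⟨v, hv⟩
  exact hL l hl1 (hl.trans hvh) hF

lemma eq_nil_of_map_inl_eq {v : Node d} {s : List ℕ} {x : Addr d}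
    (h : v.map Sum.inl = s.map Sum.inr ++ x) : s = [] := by
  cases s with
  | nil => rfl
  | cons j s =>
    cases v with
    | nil => cases h
    | cons c v => cases (List.cons.inj h).1

lemma payment_honest {h : ℕ} (ω : Env d) (r : ℕ → ℕ → ℝ) {u v : Node d} (hu : u ≠ [])
    (hs : u <:+ v) : payment (honest d h) ω r u (v.map Sum.inl)
      = r u.length (v.length - u.length) := by
  rw [payment, if_pos (delivered_honest h ω _), List.length_map,
    Finset.sum_eq_single u.length]
  · refine if_pos ⟨[], ?_⟩
    rw [identity, position_honest, List.map_nil, List.nil_append, ← List.map_drop,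
      ← List.suffix_iff_eq_drop.1 hs]
  · intro j hj hne
    rw [if_neg]
    rintro ⟨s, hs'⟩
    rw [identity, position_honest, ← List.map_drop] at hs'
    obtain rfl := eq_nil_of_map_inl_eq hs'
    have := congrArg List.length hs'
    simp only [List.length_map, List.length_drop, List.map_nil, List.nil_append] at this
    rw [Finset.mem_Icc] at hj
    omega
  · intro hn
    exact absurd (Finset.mem_Icc.2 ⟨List.length_pos_iff.2 hu, hs.length_le⟩) hn

/-- All identities of an agent lie below its first one, so being paid requires the path to pass
through that one. -/
lemma position_suffix_of_payment_ne_zero {σ : Profile d} {ω : Env d} {r : ℕ → ℕ → ℝ} {u : Node d}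
    {a : Addr d} (h : payment σ ω r u a ≠ 0) : position σ ω u <:+ a := by
  rw [payment] at h
  split_ifs at h with hD
  · obtain ⟨j, _, hj⟩ := Finset.exists_ne_zero_of_sum_ne_zero h
    split_ifs at hj with hs
    · obtain ⟨s, hs⟩ := hs
      refine List.IsSuffix.trans ?_ (List.drop_suffix (a.length - j) a)
      rw [hs]
      exact List.suffix_append _ _
    · exact absurd rfl hj
  · exact absurd rfl h

/-- The reward of an agent in the profile without sybils. -/
lemma selectionMean_payment_honest (h : ℕ) (ω : Env d) (r : ℕ → ℕ → ℝ) {u : Node d}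
    (hu : u ≠ []) :
    selectionMean (reported (honest d h) ω h) (payment (honest d h) ω r u) =
      ∑ l ∈ Finset.Icc 1 h, passProb ω u l * r u.length (l - u.length) := by
  by_cases hex : ∃ l, 1 ≤ l ∧ l ≤ h ∧ FirstAt ω l
  · obtain ⟨l, h1, hl, hL⟩ := hex
    rw [Finset.sum_eq_single l]
    · rw [passProb, if_pos hL]
      have hcl := closest_honest hL h1 hl
      by_cases hb : ∃ v ∈ answersAt ω l, u <:+ v
      · rw [selectionMean_eq (finite_closest _ _ _) (u.map Sum.inl)
          (B := r u.length (l - u.length)), hcl, walkProb_map_inl]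
        · obtain ⟨v, hv, hs⟩ := hb
          rw [hcl]
          exact ⟨_, ⟨v, hv, rfl⟩, map_inl_suffix_iff.2 hs⟩
        · rw [hcl]
          rintro _ ⟨v, hv, rfl⟩ hs
          rw [payment_honest ω r hu (map_inl_suffix_iff.1 hs), hv.1]
        · intro a _ hn
          by_contra hne
          have := position_suffix_of_payment_ne_zero hne
          rw [position_honest] at this
          exact hn this
      · rw [walkProb_eq_zero hu hb, zero_mul]
        refine selectionMean_eq_zero ?_
        rw [hcl]
        rintro _ ⟨v, hv, rfl⟩
        by_contra hne
        have := position_suffix_of_payment_ne_zero hne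
        rw [position_honest, map_inl_suffix_iff] at this
        exact hb ⟨v, hv, this⟩
    · intro m hm hne
      rw [passProb, if_neg, zero_mul]
      exact fun hF => hne (hF.unique hL (Finset.mem_Icc.1 hm).1 h1)
    · intro hn
      exact absurd (Finset.mem_Icc.2 ⟨h1, hl⟩) hn
  · push Not at hex
    rw [selectionMean_eq_zero, Finset.sum_eq_zero]
    · intro l hl
      rw [Finset.mem_Icc] at hl
      rw [passProb, if_neg (hex l hl.1 hl.2), zero_mul]
    · rw [closest_honest_eq_empty hex]
      exact fun a ha => absurd ha (Set.notMem_empty a)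

/-- The total reward paid in the profile without sybils. -/
lemma selectionMean_totalPayment_honest (h : ℕ) (ω : Env d) (r : ℕ → ℕ → ℝ) :
    selectionMean (reported (honest d h) ω h) (totalPayment (honest d h) ω r) =
      ∑ l ∈ Finset.Icc 1 h,
        (if FirstAt ω l then 1 else 0) * ∑ j ∈ Finset.Icc 1 l, r j (l - j) := by
  by_cases hex : ∃ l, 1 ≤ l ∧ l ≤ h ∧ FirstAt ω l
  · obtain ⟨l, h1, hl, hL⟩ := hex
    rw [Finset.sum_eq_single l]
    · have hcl := closest_honest hL h1 hl
      rw [if_pos hL, selectionMean_eq (finite_closest _ _ _) []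
          (B := ∑ j ∈ Finset.Icc 1 l, r j (l - j))]
      · rfl
      · obtain ⟨v, hv⟩ := hL.2
        rw [hcl]
        exact ⟨_, ⟨v, hv, rfl⟩, List.nil_suffix⟩
      · rw [hcl]
        rintro _ ⟨v, hv, rfl⟩ _
        rw [totalPayment, if_pos (delivered_honest h ω _), List.length_map, hv.1]
      · exact fun a _ hn => absurd List.nil_suffix hn
    · intro m hm hne
      rw [if_neg, zero_mul]
      exact fun hF => hne (hF.unique hL (Finset.mem_Icc.1 hm).1 h1)
    · intro hn
      exact absurd (Finset.mem_Icc.2 ⟨h1, hl⟩) hn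
  · push Not at hex
    rw [selectionMean_eq_zero, Finset.sum_eq_zero]
    · intro l hl
      rw [Finset.mem_Icc] at hl
      rw [if_neg (hex l hl.1 hl.2), zero_mul]
    · rw [closest_honest_eq_empty hex]
      exact fun a ha => absurd ha (Set.notMem_empty a)

end Game

/-! ### Pointwise bounds for the reward of a single deviating agent. -/

section Deviation

variable {d : ℕ}

lemma action_of_ne {h : ℕ} {u v : Node d} {τ : Strategy d} (ω : Env d) (hne : v ≠ u) :
    action (Function.update (honest d h) u τ) ω v =
      honestAction d h (position (Function.update (honest d h) u τ) ω v).length (ω v).2 := by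
  rw [action, Function.update_of_ne hne, honest]

lemma position_deviator (h : ℕ) (u : Node d) (τ : Strategy d) (ω : Env d) :
    position (Function.update (honest d h) u τ) ω u = u.map Sum.inl :=
  position_eq_map (h := h) ω fun _ _ hne => by rw [Function.update_of_ne hne, honest]

lemma position_of_not_suffix {h : ℕ} {u v : Node d} (τ : Strategy d) (ω : Env d)
    (hs : ¬ u <:+ v) : position (Function.update (honest d h) u τ) ω v = v.map Sum.inl :=
  position_eq_map (h := h) ω fun w hw _ => by
    rw [Function.update_of_ne, honest]
    rintro rfl
    exact hs hw

lemma action_deviator (h : ℕ) (u : Node d) (τ : Strategy d) (ω : Env d) :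
    action (Function.update (honest d h) u τ) ω u = τ u.length (ω u).2 := by
  rw [action, position_deviator, Function.update_self, List.length_map]

lemma position_below_deviator (h : ℕ) (u : Node d) (τ : Strategy d) (ω : Env d) {w : Node d}
    (hw : w ≠ []) : position (Function.update (honest d h) u τ) ω (w ++ u) =
      w.map Sum.inl ++ ((τ u.length (ω u).2).attach.map Sum.inr ++ u.map Sum.inl) := by
  induction w with
  | nil => exact absurd rfl hw
  | cons c w ih =>
    rcases eq_or_ne w [] with rfl | hw'
    · have hact := action_deviator h u τ ω
      rw [action] at hact
      rw [List.singleton_append, position, hact, position_deviator]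
      rfl
    · have hact : action (Function.update (honest d h) u τ) ω (w ++ u) = _ :=
        action_of_ne ω fun h => hw' (by simpa using h)
      rw [action] at hact
      rw [List.cons_append, position, hact, ih hw']
      rfl

/-- The identities of `u` on the path occupy levels between `u.length` and `m`; as rewards are
nonnegative, one may pretend that they occupy all of them. Refusing to forward yields `0`, which is
no better. -/
lemma payment_le_sum {h : ℕ} {u : Node d} {τ : Strategy d} {ω : Env d} {r : ℕ → ℕ → ℝ}
    (hr : ∀ j s, 1 ≤ j → 0 ≤ r j s) (hu : u ≠ []) {a : Addr d} {m : ℕ}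
    (hm : ∀ j ≤ a.length, (∃ s : List ℕ, a.drop (a.length - j) =
      s.map Sum.inr ++ u.map Sum.inl) → j ≤ m) :
    payment (Function.update (honest d h) u τ) ω r u a ≤
      ∑ j ∈ Finset.Icc u.length m, r j (a.length - j) := by
  have hu1 : 1 ≤ u.length := List.length_pos_iff.2 hu
  have hr' : ∀ j ∈ Finset.Icc u.length m, 0 ≤ r j (a.length - j) := fun j hj =>
    hr j _ (hu1.trans (Finset.mem_Icc.1 hj).1)
  rw [payment]
  split_ifs
  · rw [← Finset.sum_filter]
    refine Finset.sum_le_sum_of_subset_of_nonneg (fun j hj => ?_) fun j hj _ => hr' j hj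
    rw [Finset.mem_filter, Finset.mem_Icc] at hj
    obtain ⟨⟨_, hj⟩, s, hs⟩ := hj
    rw [identity, position_deviator] at hs
    have hl := congrArg List.length hs
    rw [List.length_drop, List.length_append, List.length_map, List.length_map] at hl
    exact Finset.mem_Icc.2 ⟨by omega, hm j hj ⟨s, hs⟩⟩
  · exact Finset.sum_nonneg hr'

/-- If an answer in the subtree of the deviating agent is among the closest ones, then the agent
would be passed at least as often if nobody created sybils. -/
lemma walkProb_deviation_le {h : ℕ} {u : Node d} {τ : Strategy d} {ω : Env d} {a : Addr d}
    (ha : a ∈ closest (reported (Function.update (honest d h) u τ) ω h))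
    (hs : u.map Sum.inl <:+ a) :
    ∃ w : Node d, Active ω (w ++ u) ∧ (ω (w ++ u)).2 = true ∧
      (w = [] → ∃ s : List ℕ, a = s.map Sum.inr ++ u.map Sum.inl) ∧
      (w ≠ [] → a = w.map Sum.inl ++
        ((τ u.length (ω u).2).attach.map Sum.inr ++ u.map Sum.inl)) ∧
      ∃ l, 1 ≤ l ∧ l ≤ w.length + u.length ∧ FirstAt ω l ∧ (∃ v ∈ answersAt ω l, u <:+ v) ∧
        walkProb (closest (reported (Function.update (honest d h) u τ) ω h)) (u.map Sum.inl) ≤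
          walkProb (answersAt ω l) u := by
  obtain ⟨v, hv0, hv, hans, s, hsp, hav⟩ := mem_reported ha.1
  -- Agents outside the subtree of `u` have addresses without sybil steps, so an answer below the
  -- position of `u` belongs to a descendant of `u`.
  have huv : u <:+ v := by
    by_contra hn
    have hne : v ≠ u := by rintro rfl; exact hn (List.suffix_refl _)
    rw [action_of_ne ω hne] at hsp
    obtain rfl : s = [] := hsp
    rw [hav, identity, position_of_not_suffix τ ω hn] at hs
    exact hn (map_inl_suffix_iff.1 hs)
  obtain ⟨w, rfl⟩ := huv
  have haw : w ≠ [] → a = w.map Sum.inl ++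
      ((τ u.length (ω u).2).attach.map Sum.inr ++ u.map Sum.inl) := by
    intro hw
    rw [action_of_ne ω (fun h => hw (by simpa using h))] at hsp
    obtain rfl : s = [] := hsp
    rw [hav, identity, position_below_deviator h u τ ω hw]
    rfl
  refine ⟨w, hv, hans, ?_, haw, ?_⟩
  · rintro rfl
    exact ⟨s, by rw [hav, identity, List.nil_append, position_deviator]⟩
  have hlen : (w ++ u).length ≤ a.length := by
    rw [hav, identity, List.length_append (as := s.map _)]
    have := length_le_length_position (Function.update (honest d h) u τ) ω (w ++ u)
    omega
  have hah : a.length ≤ h := ha.1.1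
  obtain ⟨l, hl1, hl, hL⟩ := exists_firstAt (List.length_pos_iff.2 hv0)
    ⟨w ++ u, rfl, hv, hans⟩
  -- First answers outside the subtree of `u` are still reported. The holder of `a` has level at
  -- least `l`, so `l ≤ a.length`; with the minimality of `a` this makes these answers closest too.
  have hout : ∀ v ∈ answersAt ω l, ¬ u <:+ v →
      v.map Sum.inl ∈ closest (reported (Function.update (honest d h) u τ) ω h) ∧
        a.length ≤ l := by
    intro v' hv' hn
    have hmem : v'.map Sum.inl ∈ reported (Function.update (honest d h) u τ) ω h := by
      refine map_mem_reported_of_firstAt (fun w' hw' => ?_) hL hl1 (by omega) hv'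
      rw [Function.update_of_ne, honest]
      rintro rfl
      exact hn hw'
    have hle := ha.2 _ hmem
    rw [List.length_map, hv'.1] at hle
    refine ⟨⟨hmem, fun b hb => ?_⟩, hle⟩
    have := ha.2 b hb
    rw [List.length_map, hv'.1]
    omega
  -- Otherwise a first answer outside competes with `a`, which forces `a.length ≤ l`; then the
  -- holder `w ++ u` of `a` is itself at level `l`, below `u`.
  have hin : ∃ v ∈ answersAt ω l, u <:+ v := by
    by_contra! hn
    obtain ⟨v', hv'⟩ := hL.2
    have := (hout v' hv' (hn v' hv')).2
    exact hn (w ++ u) ⟨by omega, hv, hans⟩ (List.suffix_append _ _)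
  refine ⟨l, hl1, by simpa using hl, hL, hin, ?_⟩
  rw [← walkProb_map_inl]
  refine walkProb_le_walkProb (finite_closest _ _ _) _ ?_ ⟨a, ha, hs⟩ ?_
  · rintro _ ⟨v', hv', rfl⟩
    by_cases hn : u <:+ v'
    · exact Or.inl (map_inl_suffix_iff.2 hn)
    · exact Or.inr (hout v' hv' hn).1
  · obtain ⟨v', hv', hs'⟩ := hin
    exact ⟨_, ⟨v', hv', rfl⟩, map_inl_suffix_iff.2 hs'⟩

lemma selectionMean_deviation_eq_zero {h : ℕ} {u : Node d} {τ : Strategy d} {ω : Env d}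
    {r : ℕ → ℕ → ℝ}
    (hn : ¬ ∃ a ∈ closest (reported (Function.update (honest d h) u τ) ω h),
      u.map Sum.inl <:+ a) :
    selectionMean (reported (Function.update (honest d h) u τ) ω h)
      (payment (Function.update (honest d h) u τ) ω r u) = 0 := by
  refine selectionMean_eq_zero fun a ha => ?_
  by_contra hne
  have := position_suffix_of_payment_ne_zero hne
  rw [position_deviator] at this
  exact hn ⟨a, ha, this⟩

lemma payment_deviation_eq_zero {h : ℕ} {u : Node d} {τ : Strategy d} {ω : Env d}
    {r : ℕ → ℕ → ℝ} {a : Addr d} (hn : ¬ u.map Sum.inl <:+ a) :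
    payment (Function.update (honest d h) u τ) ω r u a = 0 := by
  by_contra hne
  have := position_suffix_of_payment_ne_zero hne
  rw [position_deviator] at this
  exact hn this

/-- The reward of a deviating agent that has an answer. -/
lemma deviation_le_of_answer {h : ℕ} {u : Node d} (hu : u ≠ []) (τ : Strategy d) {ω : Env d}
    {r : ℕ → ℕ → ℝ} (hr : ∀ j s, 1 ≤ j → 0 ≤ r j s) (hans : (ω u).2 = true) {B : ℝ}
    (hB0 : 0 ≤ B)
    (hB : ∀ m, u.length ≤ m → m ≤ h → ∑ j ∈ Finset.Icc u.length m, r j (m - j) ≤ B) :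
    selectionMean (reported (Function.update (honest d h) u τ) ω h)
      (payment (Function.update (honest d h) u τ) ω r u) ≤ passProb ω u u.length * B := by
  by_cases hex : ∃ a ∈ closest (reported (Function.update (honest d h) u τ) ω h),
      u.map Sum.inl <:+ a
  · have hlive := hex
    obtain ⟨a, ha, hs⟩ := hex
    obtain ⟨w, hw, -, -, -, l, hl1, -, hL, ⟨v, hv, hs'⟩, hle⟩ := walkProb_deviation_le ha hs
    -- The first answer is not below level `u.length`, since `u` itself has one, and not above it,
    -- since some first answer is in the subtree of `u`.
    have hul : u.length = l := by
      refine le_antisymm (by rw [← hv.1]; exact hs'.length_le)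
        (hL.le (List.length_pos_iff.2 hu) ⟨u, rfl, hw.of_suffix (List.suffix_append _ _), hans⟩)
    rw [passProb, if_pos (hul ▸ hL), hul]
    refine le_trans (selectionMean_le (finite_closest _ _ _) (u.map Sum.inl) hlive (B := B)
      (fun a ha hs => ?_) fun a _ hn => payment_deviation_eq_zero hn)
      (mul_le_mul_of_nonneg_right hle hB0)
    refine (payment_le_sum hr hu (m := a.length) fun j hj _ => hj).trans (hB _ ?_ ha.1.1)
    simpa using hs.length_le
  · rw [selectionMean_deviation_eq_zero hex]
    exact mul_nonneg (passProb_nonneg _ _ _) hB0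

/-- The reward of a deviating agent that has no answer. -/
lemma deviation_le_of_no_answer {h : ℕ} {u : Node d} (hu : u ≠ []) (τ : Strategy d) {ω : Env d}
    {r : ℕ → ℕ → ℝ} (hr : ∀ j s, 1 ≤ j → 0 ≤ r j s) (hans : (ω u).2 = false) {k : ℕ}
    (hk : (τ u.length false).attach.length = k) {B : ℕ → ℝ} (hB0 : ∀ l, 0 ≤ B l)
    (hB : ∀ s l, 1 ≤ s → u.length + k + s ≤ h → u.length < l → l ≤ u.length + s →
      ∑ j ∈ Finset.Icc u.length (u.length + k), r j (u.length + k + s - j) ≤ B l) :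
    selectionMean (reported (Function.update (honest d h) u τ) ω h)
      (payment (Function.update (honest d h) u τ) ω r u) ≤
        ∑ l ∈ Finset.Icc (u.length + 1) h, passProb ω u l * B l := by
  have hnn : ∀ l ∈ Finset.Icc (u.length + 1) h, 0 ≤ passProb ω u l * B l := fun l _ =>
    mul_nonneg (passProb_nonneg _ _ _) (hB0 l)
  by_cases hex : ∃ a ∈ closest (reported (Function.update (honest d h) u τ) ω h),
      u.map Sum.inl <:+ a
  · have hlive := hex
    obtain ⟨a₀, ha₀, hs₀⟩ := hex
    obtain ⟨w₀, -, hw₀, -, haw₀, l, hl1, hl2, hL, ⟨v, hv, hs'⟩, hle⟩ :=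
      walkProb_deviation_le ha₀ hs₀
    have hw₀ne : w₀ ≠ [] := by
      rintro rfl
      rw [List.nil_append, hans] at hw₀
      cases hw₀
    have hlen₀ := congrArg List.length (haw₀ hw₀ne)
    rw [hans] at hlen₀
    simp only [List.length_append, List.length_map, hk] at hlen₀
    have hah : a₀.length ≤ h := ha₀.1.1
    have hw₀1 := List.length_pos_iff.2 hw₀ne
    have hul : u.length < l := by
      rw [← hv.1]
      refine lt_of_le_of_ne hs'.length_le fun h => ?_
      have := hv.2.2
      rw [← hs'.eq_of_length h, hans] at this
      cases this
    refine le_trans ?_ (Finset.single_le_sum hnn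
      (Finset.mem_Icc.2 ⟨hul, by omega⟩ : l ∈ Finset.Icc (u.length + 1) h))
    rw [passProb, if_pos hL]
    refine le_trans (selectionMean_le (finite_closest _ _ _) (u.map Sum.inl) hlive (B := B l)
      (fun a ha hs => ?_) fun a _ hn => payment_deviation_eq_zero hn)
      (mul_le_mul_of_nonneg_right hle (hB0 l))
    obtain ⟨w, -, hw, -, haw, -⟩ := walkProb_deviation_le ha hs
    have hwne : w ≠ [] := by
      rintro rfl
      rw [List.nil_append, hans] at hw
      cases hw
    replace haw := haw hwne
    rw [hans] at haw
    have hlen : a.length = w.length + (k + u.length) := by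
      rw [haw]
      simp only [List.length_append, List.length_map, hk]
    have hww : a.length = a₀.length := length_eq_of_mem_closest ha ha₀
    -- Every reported answer below `u` comes through the attachment identity, `k` sybil steps down.
    -- An identity of `u` further along the path would need a sybil step where the path makes a real
    -- one.
    refine (payment_le_sum hr hu (m := u.length + k) fun j hj hj' => ?_).trans ?_
    · obtain ⟨s, hs⟩ := hj'
      by_contra hlt
      have hl := congrArg List.length hs
      rw [List.length_drop, List.length_append, List.length_map, List.length_map] at hl
      rw [haw, List.drop_append_of_le_length (by rw [← haw, List.length_map]; omega),
        ← haw, ← List.map_drop] at hs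
      cases hd : w.drop (a.length - j) with
      | nil =>
        have := congrArg List.length hd
        rw [List.length_drop, List.length_nil] at this
        omega
      | cons c w' =>
        cases s with
        | nil =>
          simp only [List.length_nil] at hl
          omega
        | cons n s =>
          rw [hd] at hs
          cases (List.cons.inj hs).1
    · have hal : a.length = u.length + k + w₀.length := by omega
      rw [hal]
      exact hB _ l hw₀1 (by omega) hul (by omega)
  · rw [selectionMean_deviation_eq_zero hex]
    exact Finset.sum_nonneg hnn

end Deviation

/-! ### Measurability, and equal passing probabilities within a level. -/

section Law

variable {d : ℕ}

instance (D : PMF (Fin (d + 1))) (p : unitInterval) : IsProbabilityMeasure (law D p) := by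
  unfold law
  infer_instance

/-- Up to level `N` there are finitely many nodes, each with finitely many states, so `f` factors
through a finite discrete space. -/
lemma measurable_of_levels {β : Type*} [MeasurableSpace β] {f : Env d → β} (N : ℕ)
    (hf : ∀ ω ω' : Env d, (∀ v, v.length ≤ N → ω v = ω' v) → f ω = f ω') :
    ∃ (S : Finset (Node d)) (g : (S → Finset (Fin d) × Bool) → β),
      Measurable g ∧ f = g ∘ S.restrict := by
  refine ⟨(List.finite_length_le (Fin d) N).toFinset,
    fun x => f fun v => if hv : v ∈ (List.finite_length_le (Fin d) N).toFinset then x ⟨v, hv⟩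
      else default, measurable_of_finite _, ?_⟩
  ext ω
  refine hf _ _ fun v hv => ?_
  have : v ∈ (List.finite_length_le (Fin d) N).toFinset := by simpa using hv
  rw [dif_pos this]
  rfl

/-- A function of finitely many levels is integrable. -/
lemma integrable_of_levels (D : PMF (Fin (d + 1))) (p : unitInterval) {f : Env d → ℝ} (N : ℕ)
    (hf : ∀ ω ω' : Env d, (∀ v, v.length ≤ N → ω v = ω' v) → f ω = f ω') :
    Integrable f (law D p) := by
  obtain ⟨S, g, hg, rfl⟩ := measurable_of_levels N hf
  have hS : Measurable (S.restrict : Env d → _) := Finset.measurable_restrict S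
  have : IsProbabilityMeasure ((law D p).map S.restrict) :=
    Measure.isProbabilityMeasure_map hS.aemeasurable
  exact (Integrable.of_finite (μ := (law D p).map S.restrict)).comp_measurable hS

lemma measurableSet_of_levels {P : Env d → Prop} (N : ℕ)
    (hf : ∀ ω ω' : Env d, (∀ v, v.length ≤ N → ω v = ω' v) → P ω = P ω') :
    MeasurableSet {ω | P ω} := by
  obtain ⟨S, g, hg, rfl⟩ := measurable_of_levels N hf
  exact measurableSet_setOfPred.2 (hg.comp (Finset.measurable_restrict S))

lemma active_congr {ω ω' : Env d} {N : ℕ} (h : ∀ v, v.length ≤ N → ω v = ω' v) {v : Node d}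
    (hv : v.length ≤ N) : Active ω v ↔ Active ω' v := by
  induction v with
  | nil => rfl
  | cons c v ih =>
    have hv' : v.length ≤ N := by
      rw [List.length_cons] at hv
      omega
    rw [Active, Active, h v hv', ih hv']

lemma answersAt_congr {ω ω' : Env d} {N : ℕ} (h : ∀ v, v.length ≤ N → ω v = ω' v) {l : ℕ}
    (hl : l ≤ N) : answersAt ω l = answersAt ω' l := by
  ext v
  refine and_congr_right fun hv => ?_
  rw [active_congr h (hv.trans_le hl), h v (hv.trans_le hl)]

lemma firstAt_congr {ω ω' : Env d} {N : ℕ} (h : ∀ v, v.length ≤ N → ω v = ω' v) {l : ℕ}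
    (hl : l ≤ N) : FirstAt ω l ↔ FirstAt ω' l := by
  rw [FirstAt, FirstAt, answersAt_congr h hl]
  refine and_congr_left fun _ => forall_congr' fun m => imp_congr_right fun _ =>
    forall_congr' fun hm => ?_
  rw [answersAt_congr h (hm.le.trans hl)]

lemma integrable_passProb (D : PMF (Fin (d + 1))) (p : unitInterval) (u : Node d) (l : ℕ) :
    Integrable (fun ω => passProb ω u l) (law D p) :=
  integrable_of_levels D p l fun ω ω' h => by
    simp only [passProb, firstAt_congr h le_rfl, answersAt_congr h le_rfl]

lemma measurableSet_firstAt (l : ℕ) : MeasurableSet {ω : Env d | FirstAt ω l} :=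
  measurableSet_of_levels l fun _ _ h => propext (firstAt_congr h le_rfl)

/-- No active node of the levels `j, …, i` has an answer. -/
def noAnswer (d j i : ℕ) : Set (Env d) :=
  {ω | ∀ u : Node d, j ≤ u.length → u.length ≤ i → Active ω u → (ω u).2 = false}

lemma measurableSet_noAnswer (d i j : ℕ) : MeasurableSet (noAnswer d j i) := by
  refine measurableSet_of_levels i fun ω ω' h => propext (forall_congr' fun u =>
    imp_congr_right fun _ => forall_congr' fun hu => ?_)
  rw [active_congr h hu, h u hu]

lemma firstAnswerProb_eq (D : PMF (Fin (d + 1))) (p : unitInterval) {l : ℕ} (hl : 1 ≤ l) :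
    firstAnswerProb D p l = (law D p).real {ω | FirstAt ω l} := by
  have hsub : {ω : Env d | ∀ u : Node d, 1 ≤ u.length → u.length ≤ l → Active ω u →
      (ω u).2 = false} ⊆ {ω : Env d | ∀ u : Node d, 1 ≤ u.length → u.length ≤ l - 1 →
        Active ω u → (ω u).2 = false} := fun ω h u h1 h2 => h u h1 (by omega)
  rw [firstAnswerProb, noAnswerProb, noAnswerProb,
    ← measureReal_sdiff hsub (measurableSet_noAnswer d l 1)]
  congr 1
  ext ω
  constructor
  · rintro ⟨h1, h2⟩
    replace h2 : ¬ ∀ u : Node d, 1 ≤ u.length → u.length ≤ l → Active ω u →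
      (ω u).2 = false := h2
    push Not at h2
    obtain ⟨u, hu1, hul, hact, hans⟩ := h2
    refine ⟨fun m hm hml => Set.eq_empty_of_forall_notMem ?_, u, ?_, hact, by simpa using hans⟩
    · rintro v ⟨rfl, hv, hv'⟩
      have := h1 v hm (by omega) hv
      rw [hv'] at this
      cases this
    · by_contra hne
      exact hans (h1 u hu1 (by omega) hact)
  · rintro ⟨h1, v, rfl, hv, hans⟩
    refine ⟨fun u hu hul hact => ?_, fun h => ?_⟩
    · by_contra hb
      have : u ∈ answersAt ω u.length := ⟨rfl, hact, by simpa using hb⟩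
      rw [h1 _ hu (by omega)] at this
      exact this
    · have := h v hl le_rfl hv
      rw [hans] at this
      cases this

/-! ### Symmetry of the network -/

/-- The automorphism of the `d`-ary tree that permutes the steps made at level `m` by `π m`. -/
def permNode (π : ℕ → Equiv.Perm (Fin d)) : Node d → Node d
  | [] => []
  | c :: u => π u.length c :: permNode π u

lemma length_permNode (π : ℕ → Equiv.Perm (Fin d)) (u : Node d) :
    (permNode π u).length = u.length := by
  induction u with
  | nil => rfl
  | cons c u ih => rw [permNode, List.length_cons, List.length_cons, ih]

lemma permNode_injective (π : ℕ → Equiv.Perm (Fin d)) : Function.Injective (permNode π) :=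
  relabel_injective (g := fun u => π u.length) rfl (fun _ _ => rfl) fun u => (π u.length).injective

lemma permNode_surjective (π : ℕ → Equiv.Perm (Fin d)) : Function.Surjective (permNode π) := by
  intro v
  induction v with
  | nil => exact ⟨[], rfl⟩
  | cons c v ih =>
    obtain ⟨u, rfl⟩ := ih
    exact ⟨(π u.length).symm c :: u, by rw [permNode, Equiv.apply_symm_apply]⟩

lemma permNode_congr {π π' : ℕ → Equiv.Perm (Fin d)} {u : Node d}
    (h : ∀ m < u.length, π m = π' m) : permNode π u = permNode π' u := by
  induction u with
  | nil => rfl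
  | cons c u ih =>
    rw [permNode, permNode, h u.length (by simp), ih fun m hm => h m (by simp; omega)]

lemma exists_permNode_eq {u v : Node d} (h : u.length = v.length) :
    ∃ π : ℕ → Equiv.Perm (Fin d), permNode π u = v := by
  induction u generalizing v with
  | nil => exact ⟨fun _ => 1, (List.length_eq_zero_iff.1 h.symm).symm⟩
  | cons c u ih =>
    cases v with
    | nil => cases h
    | cons c' v =>
      obtain ⟨π, hπ⟩ := ih (v := v) (by simpa using h)
      -- The image of `u` depends only on the permutations at levels below `u.length`, so level
      -- `u.length` is free to move `c` to `c'`.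
      refine ⟨Function.update π u.length (Equiv.swap c c'), ?_⟩
      rw [permNode, Function.update_self, Equiv.swap_apply_left, ← hπ]
      congr 1
      exact permNode_congr fun m hm => Function.update_of_ne hm.ne _ _

/-- The action of the automorphism on realizations. -/
def permEnv (π : ℕ → Equiv.Perm (Fin d)) (ω : Env d) : Env d :=
  fun v => Prod.map (Finset.map (π v.length).symm.toEmbedding) id (ω (permNode π v))

lemma active_permEnv (π : ℕ → Equiv.Perm (Fin d)) (ω : Env d) (v : Node d) :
    Active (permEnv π ω) v ↔ Active ω (permNode π v) := by
  induction v with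
  | nil => rfl
  | cons c v ih =>
    rw [Active, permNode, Active, ih]
    refine and_congr_left fun _ => ?_
    simp only [permEnv, Prod.map_fst, Finset.mem_map_equiv, Equiv.symm_symm]

lemma image_answersAt_permEnv (π : ℕ → Equiv.Perm (Fin d)) (ω : Env d) (l : ℕ) :
    permNode π '' answersAt (permEnv π ω) l = answersAt ω l := by
  have hmem : ∀ v, v ∈ answersAt (permEnv π ω) l ↔ permNode π v ∈ answersAt ω l := by
    intro v
    change _ ∧ _ ∧ _ ↔ _ ∧ _ ∧ _
    rw [length_permNode, active_permEnv]
    rfl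
  ext v
  constructor
  · rintro ⟨v, hv, rfl⟩
    exact (hmem v).1 hv
  · intro hv
    obtain ⟨w, rfl⟩ := permNode_surjective π v
    exact ⟨w, (hmem w).2 hv, rfl⟩

lemma passProb_permEnv (π : ℕ → Equiv.Perm (Fin d)) (ω : Env d) (u : Node d) (l : ℕ) :
    passProb (permEnv π ω) u l = passProb ω (permNode π u) l := by
  have hF : FirstAt (permEnv π ω) l ↔ FirstAt ω l := by
    simp only [FirstAt, ← image_answersAt_permEnv π ω, Set.image_eq_empty, Set.image_nonempty]
  rw [passProb, passProb, hF, ← image_answersAt_permEnv π ω,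
    walkProb_relabel (φ := permNode π) (g := fun u => π u.length) rfl (fun _ _ => rfl)
      fun u => (π u.length).injective]

lemma map_uniformOfFinset_powersetCard (j : Fin (d + 1)) (e : Equiv.Perm (Fin d)) :
    (PMF.uniformOfFinset _ (powersetCard_nonempty j)).map (Finset.map e.toEmbedding) =
      PMF.uniformOfFinset _ (powersetCard_nonempty j) := by
  ext S
  rw [PMF.map_apply, tsum_eq_single (S.map e.symm.toEmbedding)]
  · have : (S.map e.symm.toEmbedding).map e.toEmbedding = S := by
      ext
      simp
    rw [this, if_pos rfl]
    simp only [PMF.uniformOfFinset_apply, Finset.mem_powersetCard_univ, Finset.card_map]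
  · intro T hT
    refine if_neg ?_
    rintro rfl
    apply hT
    ext
    simp

lemma map_childLaw (D : PMF (Fin (d + 1))) (e : Equiv.Perm (Fin d)) :
    (childLaw D).map (Finset.map e.toEmbedding) = childLaw D := by
  rw [childLaw, PMF.map_bind]
  simp_rw [map_uniformOfFinset_powersetCard]

/-- `permEnv` first permutes i.i.d. coordinates and then relabels the child set at each node; the
latter preserves `childLaw` because sets of each size are drawn uniformly. -/
lemma map_permEnv_law (D : PMF (Fin (d + 1))) (p : unitInterval) (π : ℕ → Equiv.Perm (Fin d)) :
    (law D p).map (permEnv π) = law D p := by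
  have hF : ∀ e : Equiv.Perm (Fin d),
      ((childLaw D).toMeasure.prod (bernoulliMeasure true false p)).map
        (Prod.map (Finset.map e.toEmbedding) id) =
      (childLaw D).toMeasure.prod (bernoulliMeasure true false p) := by
    intro e
    rw [← Measure.map_prod_map _ _ (measurable_of_finite _) measurable_id,
      PMF.toMeasure_map _ (childLaw D) (measurable_of_finite _), map_childLaw, Measure.map_id]
  have hm : ∀ v : Node d, Measurable
      (Prod.map (Finset.map (π v.length).symm.toEmbedding) id :
        Finset (Fin d) × Bool → Finset (Fin d) × Bool) := fun v => measurable_of_finite _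
  have hcomp : (permEnv π : Env d → Env d) =
      (fun ω v => Prod.map (Finset.map (π v.length).symm.toEmbedding) id (ω v)) ∘
        (fun ω v => ω (permNode π v)) := rfl
  rw [hcomp, ← Measure.map_map (by fun_prop) (by fun_prop), law,
    Measure.map_infinitePi_infinitePi_of_inj (permNode_injective π)]
  refine (Measure.infinitePi_map_pi
    (fun _ : Node d => (childLaw D).toMeasure.prod (bernoulliMeasure true false p)) hm).trans ?_
  simp_rw [hF]

lemma integral_passProb_permNode (D : PMF (Fin (d + 1))) (p : unitInterval)
    (π : ℕ → Equiv.Perm (Fin d)) (u : Node d) (l : ℕ) :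
    ∫ ω, passProb ω (permNode π u) l ∂(law D p) = ∫ ω, passProb ω u l ∂(law D p) := by
  have hm : Measurable (permEnv π : Env d → Env d) := by
    refine measurable_pi_iff.2 fun v => ?_
    exact (measurable_of_finite (Prod.map (Finset.map (π v.length).symm.toEmbedding) id)).comp
      (measurable_pi_apply (permNode π v))
  simp_rw [← passProb_permEnv]
  conv_rhs => rw [← map_permEnv_law D p π]
  rw [integral_map hm.aemeasurable]
  rw [map_permEnv_law]
  exact (integrable_passProb D p u l).aestronglyMeasurable

/-- All agents of a level are passed equally often. -/
lemma integral_passProb (D : PMF (Fin (d + 1))) (p : unitInterval) (u : Node d) {l : ℕ}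
    (hl : 1 ≤ l) (hul : u.length ≤ l) :
    (d : ℝ) ^ u.length * ∫ ω, passProb ω u l ∂(law D p) = firstAnswerProb D p l := by
  set S : Finset (Node d) := (Finset.univ : Finset (Fin u.length → Fin d)).image List.ofFn with hS
  have hmem : ∀ v, v ∈ S ↔ v.length = u.length := by
    intro v
    simp only [hS, Finset.mem_image, Finset.mem_univ, true_and]
    constructor
    · rintro ⟨f, rfl⟩
      exact List.length_ofFn
    · intro h
      refine ⟨fun i => v.get (i.cast h.symm), ?_⟩
      exact List.ext_get (by simp [h]) (by simp)
  have hcard : S.card = d ^ u.length := by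
    rw [hS, Finset.card_image_of_injective _ List.ofFn_injective]
    simp
  have h1 : ∀ v ∈ S, ∫ ω, passProb ω v l ∂(law D p) = ∫ ω, passProb ω u l ∂(law D p) := by
    intro v hv
    obtain ⟨π, rfl⟩ := exists_permNode_eq ((hmem v).1 hv).symm
    exact integral_passProb_permNode D p π u l
  -- The walk to a first answer at level `l` passes exactly one agent of the level of `u`.
  have h2 : ∀ ω : Env d, ∑ v ∈ S, passProb ω v l = {ω | FirstAt ω l}.indicator 1 ω := by
    intro ω
    by_cases hF : FirstAt ω l
    · simp only [passProb, if_pos hF]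
      rw [sum_walkProb_level (finite_answersAt ω l) hF.2 (fun _ h => h.1) hul S hmem,
        Set.indicator_of_mem (by exact hF)]
      rfl
    · rw [Set.indicator_of_notMem (by exact hF)]
      exact Finset.sum_eq_zero fun v _ => if_neg hF
  calc (d : ℝ) ^ u.length * ∫ ω, passProb ω u l ∂(law D p)
      = ∑ v ∈ S, ∫ ω, passProb ω v l ∂(law D p) := by
        rw [Finset.sum_congr rfl h1, Finset.sum_const, hcard, nsmul_eq_mul, Nat.cast_pow]
    _ = ∫ ω, ∑ v ∈ S, passProb ω v l ∂(law D p) :=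
        (integral_finsetSum _ fun v _ => integrable_passProb D p v l).symm
    _ = (law D p).real {ω | FirstAt ω l} := by
        simp_rw [h2]
        exact integral_indicator_one (measurableSet_firstAt l)
    _ = firstAnswerProb D p l := (firstAnswerProb_eq D p hl).symm

end Law

/-! ### The branching recursion for the probability of no answer. -/

section Recursion

variable {d : ℕ}

/-- The realization with the given root and the given realizations below its children. -/
def joinEnv (y : (Finset (Fin d) × Bool) × (Fin d → Env d)) : Env d :=
  fun v => if hv : v = [] then y.1 else y.2 (v.getLast hv) v.dropLast

lemma joinEnv_nil (y : (Finset (Fin d) × Bool) × (Fin d → Env d)) : joinEnv y [] = y.1 := rfl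

lemma joinEnv_append (y : (Finset (Fin d) × Bool) × (Fin d → Env d)) (w : Node d) (c : Fin d) :
    joinEnv y (w ++ [c]) = y.2 c w := by
  rw [joinEnv, dif_neg (by simp)]
  simp

lemma active_joinEnv (y : (Finset (Fin d) × Bool) × (Fin d → Env d)) (w : Node d) (c : Fin d) :
    Active (joinEnv y) (w ++ [c]) ↔ c ∈ y.1.1 ∧ Active (y.2 c) w := by
  induction w with
  | nil => exact Iff.rfl
  | cons c' w ih =>
    rw [List.cons_append, Active, ih, joinEnv_append, Active]
    tauto

lemma measurable_joinEnv : Measurable (joinEnv (d := d)) := by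
  refine measurable_pi_iff.2 fun v => ?_
  by_cases hv : v = []
  · subst hv
    exact measurable_fst
  · simp only [joinEnv, dif_neg hv]
    exact (measurable_pi_apply v.dropLast).comp
      ((measurable_pi_apply (v.getLast hv)).comp measurable_snd)

lemma prod_node {M : Type*} [CommMonoid M] (s : Finset (Node d)) (f : Node d → M) :
    ∏ v ∈ s, f v = (if [] ∈ s then f [] else 1) *
      ∏ c, ∏ w ∈ s.preimage (fun w => w ++ [c]) (List.append_left_injective [c]).injOn,
        f (w ++ [c]) := by
  rw [← Finset.prod_filter_mul_prod_filter_not s (fun v => v = []), Finset.prod_sigma']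
  congr 1
  · rw [Finset.prod_filter]
    split_ifs with h
    · rw [Finset.prod_eq_single_of_mem [] h fun v _ hv => if_neg hv, if_pos rfl]
    · exact Finset.prod_eq_one fun v hv => if_neg fun h0 => h (by rwa [h0] at hv)
  · symm
    refine Finset.prod_bij (fun x _ => x.2 ++ [x.1]) ?_ ?_ ?_ fun _ _ => rfl
    · rintro ⟨c, w⟩ h
      simpa using h
    · rintro ⟨c, w⟩ _ ⟨c', w'⟩ _ h
      obtain ⟨rfl, h2⟩ := List.append_inj' h rfl
      cases h2
      rfl
    · intro v hv
      rw [Finset.mem_filter] at hv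
      refine ⟨⟨v.getLast hv.2, v.dropLast⟩, ?_, List.dropLast_append_getLast hv.2⟩
      simpa [List.dropLast_append_getLast hv.2] using hv.1

/-- The subtrees of the children of the root are independent copies of the network. -/
lemma map_joinEnv (D : PMF (Fin (d + 1))) (p : unitInterval) :
    (((childLaw D).toMeasure.prod (bernoulliMeasure true false p)).prod
      (Measure.pi fun _ : Fin d => law D p)).map joinEnv = law D p := by
  refine Measure.eq_infinitePi _ fun s t ht => ?_
  -- An infinite product measure is determined on boxes; a box pulls back to a condition on the root
  -- times one box per child. Since paths list the last choice first, the subtree of `c` consists of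
  -- the nodes `w ++ [c]`.
  have hpre : joinEnv ⁻¹' Set.pi (s : Set (Node d)) t =
      {x | [] ∈ s → x ∈ t []} ×ˢ Set.pi Set.univ fun c =>
        Set.pi (s.preimage (fun w => w ++ [c]) (List.append_left_injective [c]).injOn : Set (Node d))
          fun w => t (w ++ [c]) := by
    ext y
    simp only [Set.mem_preimage, Set.mem_pi, Set.mem_prod, Set.mem_univ, forall_true_left,
      Finset.mem_coe, Finset.mem_preimage, Set.mem_ofPred_eq]
    constructor
    · intro h
      refine ⟨h [], fun c w hw => ?_⟩
      rw [← joinEnv_append]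
      exact h _ hw
    · rintro ⟨h0, h1⟩ v hv
      by_cases hv0 : v = []
      · subst hv0
        exact h0 hv
      · rw [← List.dropLast_append_getLast hv0, joinEnv_append]
        exact h1 _ _ (by rwa [List.dropLast_append_getLast hv0])
  rw [Measure.map_apply measurable_joinEnv (.pi s.countable_toSet fun v _ => ht v), hpre,
    Measure.prod_prod, Measure.pi_pi, prod_node]
  congr 1
  · split_ifs with h
    · simp [h]
    · simp [h]
  · refine Finset.prod_congr rfl fun c _ => ?_
    exact Measure.infinitePi_pi _ fun w _ => ht _

/-- A child of the root is the root of its own subtree, where its answer counts; hence the lower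
level drops from `1` to `0`. -/
lemma joinEnv_mem_noAnswer_one (i : ℕ) (y : (Finset (Fin d) × Bool) × (Fin d → Env d)) :
    joinEnv y ∈ noAnswer d 1 (i + 1) ↔ ∀ c ∈ y.1.1, y.2 c ∈ noAnswer d 0 i := by
  constructor
  · intro h c hc u _ hu hact
    have := h (u ++ [c]) (by simp) (by simpa using hu) ((active_joinEnv y u c).2 ⟨hc, hact⟩)
    rwa [joinEnv_append] at this
  · intro h v hv hvl hact
    have hv0 : v ≠ [] := by
      rintro rfl
      simp at hv
    obtain ⟨w, c, rfl⟩ : ∃ w c, v = w ++ [c] := ⟨_, _, (List.dropLast_append_getLast hv0).symm⟩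
    rw [active_joinEnv] at hact
    rw [joinEnv_append]
    exact h c hact.1 w (Nat.zero_le _) (by simpa using hvl) hact.2

lemma mem_noAnswer_zero (i : ℕ) (ω : Env d) :
    ω ∈ noAnswer d 0 i ↔ (ω []).2 = false ∧ ω ∈ noAnswer d 1 i := by
  constructor
  · intro h
    exact ⟨h [] le_rfl (Nat.zero_le _) trivial, fun u _ => h u (Nat.zero_le _)⟩
  · rintro ⟨h0, h1⟩ u _ hu hact
    rcases Nat.eq_zero_or_pos u.length with h | h
    · obtain rfl := List.length_eq_zero_iff.1 h
      exact h0
    · exact h1 u h hu hact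

lemma lintegral_childLaw (D : PMF (Fin (d + 1))) (x : ENNReal) :
    ∫⁻ S, x ^ S.card ∂(childLaw D).toMeasure = ∑ j : Fin (d + 1), D j * x ^ (j : ℕ) := by
  rw [lintegral_fintype]
  simp_rw [PMF.toMeasure_apply_singleton _ _ (MeasurableSet.singleton _), childLaw,
    PMF.bind_apply, tsum_fintype, Finset.mul_sum]
  rw [Finset.sum_comm]
  refine Finset.sum_congr rfl fun j _ => ?_
  have h1 : ∀ S : Finset (Fin d),
      x ^ S.card * (D j * (PMF.uniformOfFinset _ (powersetCard_nonempty j)) S) =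
        D j * x ^ (j : ℕ) * (PMF.uniformOfFinset _ (powersetCard_nonempty j)) S := by
    intro S
    by_cases hS : S.card = j
    · rw [hS]
      ring
    · rw [PMF.uniformOfFinset_apply_of_notMem _ (by simpa using hS)]
      simp
  simp_rw [h1]
  rw [← Finset.mul_sum, ← tsum_fintype (L := .unconditional _), PMF.tsum_coe, mul_one]

/-- Given the set of children, their subtrees lie in `G` independently of each other and of the
answer at the root. Averaging over the number of children gives the generating function of `D`. -/
lemma law_root (D : PMF (Fin (d + 1))) (p : unitInterval) (G : Set (Env d))
    (B : Set Bool) {H : Set (Env d)} (hH : MeasurableSet H)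
    (hGH : ∀ y, joinEnv y ∈ H ↔ y.1.2 ∈ B ∧ ∀ c ∈ y.1.1, y.2 c ∈ G) :
    law D p H = (∑ j : Fin (d + 1), D j * law D p G ^ (j : ℕ)) *
      bernoulliMeasure true false p B := by
  have hslice : ∀ x : Finset (Fin d) × Bool,
      (Measure.pi fun _ : Fin d => law D p) (Prod.mk x ⁻¹' (joinEnv ⁻¹' H)) =
        law D p G ^ x.1.card * B.indicator 1 x.2 := by
    intro x
    by_cases hx : x.2 ∈ B
    · have : Prod.mk x ⁻¹' (joinEnv ⁻¹' H) =
          Set.pi Set.univ fun c => if c ∈ x.1 then G else Set.univ := by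
        ext e
        rw [Set.mem_preimage, Set.mem_preimage, hGH, Set.mem_pi]
        simp only [hx, true_and, Set.mem_univ, forall_true_left]
        refine forall_congr' fun c => ?_
        split_ifs with h <;> simp [h]
      rw [this, Measure.pi_pi, Set.indicator_of_mem hx, Pi.one_apply, mul_one]
      simp_rw [apply_ite (law D p), measure_univ]
      rw [Finset.prod_ite_mem, Finset.univ_inter, Finset.prod_const]
    · have : Prod.mk x ⁻¹' (joinEnv ⁻¹' H) = ∅ := by
        ext e
        rw [Set.mem_preimage, Set.mem_preimage, hGH]
        simp [hx]
      rw [this, measure_empty, Set.indicator_of_notMem hx, mul_zero]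
  conv_lhs => rw [← map_joinEnv, Measure.map_apply measurable_joinEnv hH,
    Measure.prod_apply (measurable_joinEnv hH)]
  simp_rw [hslice]
  rw [lintegral_prod_mul (f := fun S : Finset (Fin d) => law D p G ^ S.card)
    (g := B.indicator 1) (measurable_of_finite _).aemeasurable
    (measurable_of_finite _).aemeasurable, lintegral_childLaw,
    lintegral_indicator_one (MeasurableSet.of_discrete)]

lemma law_noAnswer_zero (D : PMF (Fin (d + 1))) (p : unitInterval) (i : ℕ) :
    law D p (noAnswer d 0 i) = law D p (noAnswer d 1 i) *
      bernoulliMeasure true false p {false} := by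
  cases i with
  | zero =>
    have huniv : noAnswer d 1 0 = Set.univ := by
      refine Set.eq_univ_of_forall fun ω u h1 h2 => ?_
      omega
    rw [law_root D p Set.univ {false} (measurableSet_noAnswer d 0 0), huniv]
    · simp only [measure_univ, one_pow, mul_one]
      rw [← tsum_fintype (L := .unconditional _), PMF.tsum_coe]
    · intro y
      rw [mem_noAnswer_zero, huniv, joinEnv_nil]
      simp
  | succ i =>
    rw [law_root D p (noAnswer d 0 i) {false} (measurableSet_noAnswer d (i + 1) 0),
      law_root D p (noAnswer d 0 i) Set.univ (measurableSet_noAnswer d (i + 1) 1),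
      measure_univ, mul_one]
    · intro y
      rw [joinEnv_mem_noAnswer_one]
      simp [noAnswer]
    · intro y
      rw [mem_noAnswer_zero, joinEnv_mem_noAnswer_one, joinEnv_nil]
      rfl

lemma noAnswerProb_zero (D : PMF (Fin (d + 1))) (p : unitInterval) : noAnswerProb D p 0 = 1 := by
  have huniv : {ω : Env d | ∀ u : Node d, 1 ≤ u.length → u.length ≤ 0 → Active ω u →
      (ω u).2 = false} = Set.univ := by
    refine Set.eq_univ_of_forall fun ω u h1 h2 => ?_
    omega
  rw [noAnswerProb, huniv]
  exact probReal_univ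

lemma noAnswerProb_succ (D : PMF (Fin (d + 1))) (p : unitInterval) (i : ℕ) :
    noAnswerProb D p (i + 1) =
      ∑ j : Fin (d + 1), (D j).toReal * ((1 - (p : ℝ)) * noAnswerProb D p i) ^ (j : ℕ) := by
  have hb : (bernoulliMeasure true false p {false}).toReal = 1 - (p : ℝ) := by
    have := bernoulliMeasure_real_apply (x := true) (y := false) p
      (MeasurableSet.singleton false)
    rw [measureReal_def] at this
    rw [this]
    simp
  have h1 : law D p (noAnswer d 1 (i + 1)) =
      (∑ j : Fin (d + 1), D j * law D p (noAnswer d 0 i) ^ (j : ℕ)) *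
        bernoulliMeasure true false p Set.univ :=
    law_root D p (noAnswer d 0 i) Set.univ (measurableSet_noAnswer d (i + 1) 1)
      fun y => by
        rw [joinEnv_mem_noAnswer_one]
        simp [noAnswer]
  change (law D p (noAnswer d 1 (i + 1))).toReal = _
  rw [h1, measure_univ, mul_one, ENNReal.toReal_sum fun j _ =>
    ENNReal.mul_ne_top (PMF.apply_ne_top D j) (ENNReal.pow_ne_top (measure_ne_top _ _))]
  refine Finset.sum_congr rfl fun j _ => ?_
  rw [ENNReal.toReal_mul, ENNReal.toReal_pow, law_noAnswer_zero, ENNReal.toReal_mul, hb, mul_comm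
    (1 - (p : ℝ))]
  rfl

end Recursion

/-! ### Elementary bounds for the parent rewards `x_i`. -/

section Referral

variable {lam : ℕ → ℝ} {h : ℕ}

lemma referral_eq_zero {i : ℕ} (hi : h ≤ i) : referral lam h i = 0 := by
  rw [referral, dif_neg (by omega)]

lemma le_referral {i j : ℕ} (hij : i < j) (hj : j ≤ h) :
    referral lam h j + ((j : ℝ) - i) / lam (i + 1) * ∑ l ∈ Finset.Icc (i + 1) h, lam l ≤
      referral lam h i := by
  rw [referral.eq_1 lam h i, dif_pos (by omega)]
  exact Finset.le_sup' (fun j : {x // x ∈ Finset.Icc (i + 1) h} => referral lam h j.1 +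
    ((j.1 : ℝ) - i) / lam (i + 1) * ∑ l ∈ Finset.Icc (i + 1) h, lam l)
    (Finset.mem_attach _ ⟨j, Finset.mem_Icc.2 ⟨hij, hj⟩⟩)

lemma referral_le {i : ℕ} (hi : i < h) {B : ℝ} (hB : ∀ j, i < j → j ≤ h →
    referral lam h j + ((j : ℝ) - i) / lam (i + 1) * ∑ l ∈ Finset.Icc (i + 1) h, lam l ≤ B) :
    referral lam h i ≤ B := by
  rw [referral.eq_1 lam h i, dif_pos hi]
  refine Finset.sup'_le _ _ fun j _ => ?_
  have := Finset.mem_Icc.1 j.2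
  exact hB j.1 this.1 this.2

lemma le_mul_sum (hlam : ∀ l, 1 ≤ l → 0 < lam l) {i : ℕ} (hi : i < h) {c : ℝ} (hc : 0 ≤ c) :
    c ≤ c / lam (i + 1) * ∑ l ∈ Finset.Icc (i + 1) h, lam l := by
  have h1 : lam (i + 1) ≤ ∑ l ∈ Finset.Icc (i + 1) h, lam l :=
    Finset.single_le_sum (f := lam)
      (fun l hl => (hlam l (by have := (Finset.mem_Icc.1 hl).1; omega)).le)
      (Finset.mem_Icc.2 ⟨le_rfl, hi⟩)
  have h0 := hlam (i + 1) (by omega)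
  calc c = c / lam (i + 1) * lam (i + 1) := by field_simp
    _ ≤ _ := mul_le_mul_of_nonneg_left h1 (div_nonneg hc h0.le)

/-- The choice `j = h` in the maximum already gives at least `h - i ≥ 1`, because the sum contains
`lam (i + 1)`. -/
lemma one_le_referral (hlam : ∀ l, 1 ≤ l → 0 < lam l) {i : ℕ} (hi : i < h) :
    1 ≤ referral lam h i := by
  have h1 := le_referral (lam := lam) hi le_rfl
  rw [referral_eq_zero le_rfl, zero_add] at h1
  have h2 : (1 : ℝ) ≤ (h : ℝ) - i := by
    have : (i : ℝ) + 1 ≤ h := by exact_mod_cast hi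
    linarith
  exact (h2.trans (le_mul_sum hlam hi (by linarith))).trans h1

lemma referral_nonneg (hlam : ∀ l, 1 ≤ l → 0 < lam l) (i : ℕ) : 0 ≤ referral lam h i := by
  rcases lt_or_ge i h with hi | hi
  · exact zero_le_one.trans (one_le_referral hlam hi)
  · exact (referral_eq_zero hi).ge

lemma sum_referral_nonneg (hlam : ∀ l, 1 ≤ l → 0 < lam l) (s : Finset ℕ) :
    0 ≤ ∑ j ∈ s, referral lam h j :=
  Finset.sum_nonneg fun j _ => referral_nonneg hlam j

end Referral

/-! ### Total rewards along segments of an answer path. -/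

section Reward

variable {d : ℕ} {D : PMF (Fin (d + 1))} {p : unitInterval} {h : ℕ}

lemma drReward_zero {i : ℕ} (hi : i ≤ h) :
    drReward D p h i 0 =
      (h : ℝ) - i + 1 + ∑ j ∈ Finset.Icc i h, referral (firstAnswerProb D p) h j := by
  rw [drReward, if_pos (by omega), if_pos rfl, holderReward]

lemma drReward_one {i : ℕ} (hi : i + 1 ≤ h) :
    drReward D p h i 1 = referral (firstAnswerProb D p) h i := by
  rw [drReward, if_pos hi, if_neg one_ne_zero, if_pos rfl]

lemma drReward_of_two_le {i s : ℕ} (hs : 2 ≤ s) (hi : i + s ≤ h) : drReward D p h i s = 1 := by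
  rw [drReward, if_pos hi, if_neg (by omega), if_neg (by omega)]

lemma isDirectReferral_drReward (hlam : ∀ l, 1 ≤ l → 0 < firstAnswerProb D p l) :
    IsDirectReferral h (drReward D p h) := by
  intro i s hi his
  refine ⟨?_, fun hs => drReward_of_two_le hs his⟩
  rcases Nat.lt_or_ge s 2 with hs | hs
  · interval_cases s
    · rw [drReward_zero (show i ≤ h from his)]
      have h1 := sum_referral_nonneg (h := h) hlam (Finset.Icc i h)
      have h2 : (i : ℝ) ≤ h := by exact_mod_cast (show i ≤ h from his)
      linarith
    · rw [drReward_one his]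
      exact one_le_referral hlam his
  · exact (drReward_of_two_le hs his).ge

lemma drReward_nonneg (hlam : ∀ l, 1 ≤ l → 0 < firstAnswerProb D p l) {i : ℕ} (s : ℕ)
    (hi : 1 ≤ i) : 0 ≤ drReward D p h i s := by
  by_cases his : i + s ≤ h
  · exact zero_le_one.trans (isDirectReferral_drReward hlam i s hi his).1
  · rw [drReward, if_neg his]

lemma sum_drReward_Ico {i m s : ℕ} (him : i ≤ m) (hs : 1 ≤ s) (hm : m + s ≤ h) :
    ∑ j ∈ Finset.Ico i m, drReward D p h j (m + s - j) = (m : ℝ) - i := by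
  rw [Finset.sum_congr rfl (g := fun _ => (1 : ℝ))]
  · rw [Finset.sum_const, Nat.card_Ico, nsmul_eq_mul, mul_one, Nat.cast_sub him]
  · intro j hj
    rw [Finset.mem_Ico] at hj
    exact drReward_of_two_le (by omega) (by omega)

/-- The total reward of a segment of an answer path that ends at the answer holder. -/
lemma sum_drReward_le {i m : ℕ} (him : i ≤ m)
    (hm : m ≤ h) : ∑ j ∈ Finset.Icc i m, drReward D p h j (m - j) ≤
      (h : ℝ) - i + 1 + ∑ j ∈ Finset.Icc (max i (m - 1)) h, referral (firstAnswerProb D p) h j := by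
  rcases him.eq_or_lt with rfl | hlt
  · rw [Finset.Icc_self, Finset.sum_singleton, Nat.sub_self, drReward_zero hm,
      max_eq_left (by omega)]
  · obtain ⟨m, rfl⟩ := Nat.exists_eq_succ_of_ne_zero (by omega : m ≠ 0)
    have h1 := sum_drReward_Ico (D := D) (p := p) (i := i) (m := m) (s := 1) (by omega) le_rfl hm
    -- The holder is now at level `m + 1`: the levels `i, …, m - 1` earn one each, and the parent's
    -- `x_m` completes the holder's sum of `x_j` over `j ≥ m + 1`.
    have h2 : ∑ j ∈ Finset.Icc m h, referral (firstAnswerProb D p) h j =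
        referral (firstAnswerProb D p) h m +
          ∑ j ∈ Finset.Icc (m + 1) h, referral (firstAnswerProb D p) h j := by
      rw [Finset.Icc_add_one_left_eq_Ioc, Finset.add_sum_Ioc_eq_sum_Icc (by omega)]
    rw [Nat.succ_eq_add_one, Finset.sum_Icc_succ_top (by omega),
      ← Finset.Ico_insert_right (by omega : i ≤ m), Finset.sum_insert (by simp), h1, Nat.sub_self,
      Nat.add_sub_cancel_left, drReward_zero hm, drReward_one hm, Nat.add_sub_cancel,
      max_eq_right (by omega), h2]
    push_cast
    linarith

/-- The reward of a holder at level `i` already includes one unit for every later level and all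
later `x_j`, so splitting into a chain of identities gains nothing. -/
lemma sum_drReward_le_drReward_zero (hlam : ∀ l, 1 ≤ l → 0 < firstAnswerProb D p l) {i m : ℕ}
    (him : i ≤ m) (hm : m ≤ h) :
    ∑ j ∈ Finset.Icc i m, drReward D p h j (m - j) ≤ drReward D p h i 0 := by
  refine (sum_drReward_le him hm).trans ?_
  rw [drReward_zero (by omega)]
  refine add_le_add le_rfl (Finset.sum_le_sum_of_subset_of_nonneg
    (Finset.Icc_subset_Icc_left (le_max_left _ _)) fun j _ _ => referral_nonneg hlam j)

/-- The total reward of the identities at the levels `i, …, i + k` if the answer holder is `s`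
levels further down. -/
lemma sum_drReward_sybils_le (hlam : ∀ l, 1 ≤ l → 0 < firstAnswerProb D p l) {i k s l : ℕ}
    (hs : 1 ≤ s) (hk : i + k + s ≤ h) (hl : l ≤ i + s) :
    ∑ j ∈ Finset.Icc i (i + k), drReward D p h j (i + k + s - j) ≤
      k + if l ≤ i + 1 then referral (firstAnswerProb D p) h (i + k) else 1 := by
  rw [← Finset.Ico_insert_right (by omega : i ≤ i + k), Finset.sum_insert (by simp),
    sum_drReward_Ico (by omega) hs hk, Nat.add_sub_cancel_left]
  push_cast
  have h1 := one_le_referral hlam (by omega : i + k < h)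
  -- Only for `s = 1` does the last identity earn `x_{i+k}`, and then `l ≤ i + 1`. For `s ≥ 2` it
  -- earns one, which is below either bound because `x_{i+k} ≥ 1`.
  rcases hs.eq_or_lt with rfl | hs2
  · rw [if_pos hl, drReward_one hk]
    linarith
  · rw [drReward_of_two_le hs2 hk]
    split_ifs <;> linarith

end Reward

/-! ### Convexity of the generating function and the growth of the referral rewards. -/

section Growth

variable {d : ℕ}

/-- Quantitative convexity: the right side is `1 - q` times the gap at `t` between `t ^ j` and its
chord over `[q, 1]`. Equality holds at `j = 2`, and passing to `j + 1` adds `(1 - t) * (1 - q) * (t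
^ j - q ^ j) ≥ 0`. -/
lemma chord_pow_le {q t : ℝ} (hq : 0 ≤ q) (hqt : q ≤ t) (ht : t ≤ 1) (j : ℕ) :
    (if 2 ≤ j then (1 - q) * (t - q) * (1 - t) else 0) ≤
      (t - q) + (1 - t) * q ^ j - (1 - q) * t ^ j := by
  induction j with
  | zero => simp
  | succ j ih =>
    rcases Nat.lt_or_ge j 2 with hj | hj
    · interval_cases j
      · norm_num
        nlinarith
      · norm_num
        nlinarith
    · rw [if_pos hj] at ih
      rw [if_pos (by omega)]
      have h1 : q ^ j ≤ t ^ j := pow_le_pow_left₀ hq hqt j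
      have h2 : 0 ≤ (1 - t) * (1 - q) * (t ^ j - q ^ j) :=
        mul_nonneg (mul_nonneg (by linarith) (by linarith)) (by linarith)
      rw [pow_succ, pow_succ]
      nlinarith

lemma sum_toReal (D : PMF (Fin (d + 1))) : ∑ j, (D j).toReal = 1 := by
  rw [← ENNReal.toReal_sum fun j _ => PMF.apply_ne_top D j,
    ← tsum_fintype (L := .unconditional _), PMF.tsum_coe, ENNReal.toReal_one]

lemma exists_two_le {D : PMF (Fin (d + 1))} (hb : 1 < branchingFactor D) :
    ∃ j : Fin (d + 1), 2 ≤ (j : ℕ) ∧ 0 < (D j).toReal := by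
  by_contra! hn
  refine hb.not_ge ?_
  rw [branchingFactor, ← sum_toReal D]
  refine Finset.sum_le_sum fun j _ => ?_
  rcases Nat.lt_or_ge (j : ℕ) 2 with hj | hj
  · have h1 : ((j : ℕ) : ℝ) ≤ 1 := by exact_mod_cast Nat.lt_succ_iff.1 hj
    exact mul_le_of_le_one_left ENNReal.toReal_nonneg h1
  · rw [le_antisymm (hn j hj) ENNReal.toReal_nonneg, mul_zero]

lemma offspring_lt {D : PMF (Fin (d + 1))} (hb : 1 < branchingFactor D) {s t : ℝ} (hs : 0 ≤ s)
    (hst : s < t) :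
    ∑ j : Fin (d + 1), (D j).toReal * s ^ (j : ℕ) < ∑ j : Fin (d + 1), (D j).toReal * t ^ (j : ℕ) := by
  obtain ⟨j, hj, hD⟩ := exists_two_le hb
  refine Finset.sum_lt_sum (fun i _ => mul_le_mul_of_nonneg_left
    (pow_le_pow_left₀ hs hst.le _) ENNReal.toReal_nonneg) ⟨j, Finset.mem_univ j, ?_⟩
  exact mul_lt_mul_of_pos_left (pow_lt_pow_left₀ hst hs (by omega)) hD

variable {D : PMF (Fin (d + 1))} {p : unitInterval}

lemma noAnswerProb_nonneg (i : ℕ) : 0 ≤ noAnswerProb D p i := measureReal_nonneg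

/-- The probabilities are the iterates, started at `1`, of a strictly increasing map that moves `1`
down. Strictness makes every `λ_l` positive, as the division by `λ_{i+1}` requires. -/
lemma noAnswerProb_succ_lt (hb : 1 < branchingFactor D) (hp0 : 0 < (p : ℝ)) (hp1 : (p : ℝ) < 1)
    (i : ℕ) : noAnswerProb D p (i + 1) < noAnswerProb D p i := by
  induction i with
  | zero =>
    rw [noAnswerProb_succ, noAnswerProb_zero, mul_one]
    calc _ < ∑ j : Fin (d + 1), (D j).toReal * (1 : ℝ) ^ (j : ℕ) :=
          offspring_lt hb (by linarith) (by linarith)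
      _ = 1 := by simp [sum_toReal]
  | succ i ih =>
    rw [noAnswerProb_succ D p (i + 1)]
    conv_rhs => rw [noAnswerProb_succ]
    exact offspring_lt hb (mul_nonneg (by linarith) (noAnswerProb_nonneg _))
      (mul_lt_mul_of_pos_left ih (by linarith))

lemma firstAnswerProb_pos (hb : 1 < branchingFactor D) (hp0 : 0 < (p : ℝ)) (hp1 : (p : ℝ) < 1)
    (l : ℕ) (hl : 1 ≤ l) : 0 < firstAnswerProb D p l := by
  obtain ⟨l, rfl⟩ := Nat.exists_eq_add_of_le' hl
  rw [firstAnswerProb, Nat.add_sub_cancel, sub_pos]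
  exact noAnswerProb_succ_lt hb hp0 hp1 l

lemma sum_firstAnswerProb {i m : ℕ} (him : i ≤ m) :
    ∑ l ∈ Finset.Icc (i + 1) m, firstAnswerProb D p l = noAnswerProb D p i - noAnswerProb D p m := by
  induction m, him using Nat.le_induction with
  | base => simp
  | succ m him ih =>
    rw [Finset.sum_Icc_succ_top (by omega), ih, firstAnswerProb, Nat.add_sub_cancel]
    ring

/-- The probability that the first answer is at level `i + 1` is not much smaller than the
probability that it is at a level `≤ i + 1` times the probability that it is at a level
between `i + 1` and `h`. -/
lemma exists_growth_bound (hb : 1 < branchingFactor D) :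
    ∃ K : ℝ, 0 ≤ K ∧ ∀ p : unitInterval, 0 < (p : ℝ) → (p : ℝ) < 1 / 2 → ∀ i h : ℕ, i < h →
      (1 - noAnswerProb D p (i + 1)) * (noAnswerProb D p i - noAnswerProb D p h) ≤
        K * firstAnswerProb D p (i + 1) := by
  obtain ⟨j₀, hj₀, hD⟩ := exists_two_le hb
  -- A lower bound, uniform in `p < 1 / 2`, for the coefficient of `t ^ j₀` in the generating
  -- function at `(1 - p) t`.
  set κ : ℝ := (D j₀).toReal * (1 / 2) ^ (j₀ : ℕ) with hκ
  have hκ0 : 0 < κ := by positivity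
  refine ⟨κ⁻¹ + 1, by positivity, fun p hp0 hp i h hih => ?_⟩
  have hanti : StrictAnti (noAnswerProb D p) :=
    strictAnti_nat_of_succ_lt fun i => noAnswerProb_succ_lt hb hp0 (by linarith) i
  rw [firstAnswerProb, Nat.add_sub_cancel]
  have e1 := noAnswerProb_succ D p i
  have e2 := noAnswerProb_succ D p h
  have e3 := noAnswerProb_succ D p 0
  have l1 := hanti (Nat.lt_succ_self i)
  have l2 := hanti (Nat.lt_succ_self h)
  have l3 := hanti (Nat.lt_succ_self 0)
  have l4 := hanti hih
  have l5 := hanti (show 0 < h by omega)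
  have l6 := hanti.antitone (Nat.zero_le i)
  have l7 := noAnswerProb_nonneg (D := D) (p := p) h
  rw [noAnswerProb_zero] at e3 l3 l5 l6
  simp only [Nat.succ_eq_add_one, zero_add] at l1 l2 l3 e3
  set t := noAnswerProb D p i
  set q := noAnswerProb D p h
  set t' := noAnswerProb D p (i + 1)
  set q' := noAnswerProb D p (h + 1)
  set o' := noAnswerProb D p 1
  -- The chord inequalities for powers, averaged with weights `D j * (1 - p) ^ j`: `o'`, `q'`, `t'`
  -- are the values of the iterated map at `1`, `q`, `t`. Only the term `j₀` is kept.
  have hchord : κ * ((1 - q) * (t - q) * (1 - t)) ≤ (t - q) * o' + (1 - t) * q' - (1 - q) * t' := by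
    have hsum : (t - q) * o' + (1 - t) * q' - (1 - q) * t' = ∑ j : Fin (d + 1),
        (D j).toReal * (1 - (p : ℝ)) ^ (j : ℕ) *
          ((t - q) + (1 - t) * q ^ (j : ℕ) - (1 - q) * t ^ (j : ℕ)) := by
      rw [e1, e2, e3, Finset.mul_sum, Finset.mul_sum, Finset.mul_sum, ← Finset.sum_add_distrib,
        ← Finset.sum_sub_distrib]
      refine Finset.sum_congr rfl fun j _ => ?_
      simp only [mul_pow, one_pow]
      ring
    have hterm : ∀ j : Fin (d + 1), (0 : ℝ) ≤
        (t - q) + (1 - t) * q ^ (j : ℕ) - (1 - q) * t ^ (j : ℕ) := fun j =>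
      le_trans (by
        split_ifs
        · exact mul_nonneg (mul_nonneg (by linarith) (by linarith)) (by linarith)
        · exact le_rfl) (chord_pow_le l7 l4.le l6 (j : ℕ))
    have hw : ∀ j : Fin (d + 1), (0 : ℝ) ≤ (D j).toReal * (1 - (p : ℝ)) ^ (j : ℕ) := fun j =>
      mul_nonneg ENNReal.toReal_nonneg (pow_nonneg (by linarith) _)
    rw [hsum]
    refine le_trans ?_ (Finset.single_le_sum (fun j _ => mul_nonneg (hw j) (hterm j))
      (Finset.mem_univ j₀))
    have h1 := chord_pow_le l7 l4.le l6 (j₀ : ℕ)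
    rw [if_pos hj₀] at h1
    refine mul_le_mul ?_ h1 (mul_nonneg (mul_nonneg (by linarith) (by linarith)) (by linarith))
      (hw j₀)
    exact mul_le_mul_of_nonneg_left (pow_le_pow_left₀ (by norm_num) (by linarith) _) hD.le
  -- As `o' ≤ 1` and `q' ≤ q`, the chord is below the diagonal: `(t - q) * o' + (1 - t) * q' ≤ (1 -
  -- q) * t`.
  have h1 : (1 - q) * (κ * ((t - q) * (1 - t))) ≤ (1 - q) * (t - t') := by
    have := mul_le_mul_of_nonneg_left l3.le (show 0 ≤ t - q by linarith)
    have := mul_le_mul_of_nonneg_left l2.le (show 0 ≤ 1 - t by linarith)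
    nlinarith
  have h2 : κ * ((t - q) * (1 - t)) ≤ t - t' := le_of_mul_le_mul_left h1 (by linarith)
  have h3 : (t - q) * (1 - t) ≤ κ⁻¹ * (t - t') := by
    rw [inv_mul_eq_div, le_div_iff₀ hκ0, mul_comm]
    exact h2
  have h4 : (t - t') * (t - q) ≤ (t - t') * 1 :=
    mul_le_mul_of_nonneg_left (by linarith) (by linarith)
  nlinarith

/-- The rewards of the parents of answer holders are at most linear in the height, relative to the
probability that they are needed. -/
lemma referral_mul_le (hb : 1 < branchingFactor D) (hp0 : 0 < (p : ℝ)) (hp1 : (p : ℝ) < 1)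
    {K : ℝ} {h : ℕ} (hK : ∀ i, i < h →
      (1 - noAnswerProb D p (i + 1)) * (noAnswerProb D p i - noAnswerProb D p h) ≤
        K * firstAnswerProb D p (i + 1)) {i : ℕ} (hi : i ≤ h) :
    referral (firstAnswerProb D p) h i * (1 - noAnswerProb D p (i + 1)) ≤ ((h : ℝ) - i) * K := by
  have hanti : StrictAnti (noAnswerProb D p) :=
    strictAnti_nat_of_succ_lt fun i => noAnswerProb_succ_lt hb hp0 hp1 i
  obtain ⟨n, hn⟩ : ∃ n, n = h - i := ⟨_, rfl⟩
  induction n using Nat.strong_induction_on generalizing i with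
  | _ n ih =>
    rcases hi.eq_or_lt with rfl | hlt
    · rw [referral_eq_zero le_rfl, sub_self, zero_mul, zero_mul]
    · have hpos : ∀ m, 0 < 1 - noAnswerProb D p (m + 1) := by
        intro m
        have := hanti (Nat.succ_pos m)
        rw [noAnswerProb_zero] at this
        exact sub_pos.2 this
      rw [← le_div_iff₀ (hpos i)]
      refine referral_le hlt fun j hij hj => ?_
      rw [le_div_iff₀ (hpos i), add_mul, sum_firstAnswerProb hi]
      have hlam := firstAnswerProb_pos hb hp0 hp1 (i + 1) (by omega)
      -- The two terms of the maximum contribute `(h - j) * K` and `(j - i) * K`, which add up to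
      -- `(h - i) * K` whichever `j` attains it.
      have h1 : referral (firstAnswerProb D p) h j * (1 - noAnswerProb D p (i + 1)) ≤
          ((h : ℝ) - j) * K := by
        refine le_trans (mul_le_mul_of_nonneg_left ?_
          (referral_nonneg (firstAnswerProb_pos hb hp0 hp1) j)) (ih (h - j) (by omega) hj rfl)
        have := hanti.antitone (show i + 1 ≤ j + 1 by omega)
        linarith
      have hij' : (0 : ℝ) ≤ (j : ℝ) - i := sub_nonneg.2 (by exact_mod_cast hij.le)
      have h2 : ((j : ℝ) - i) / firstAnswerProb D p (i + 1) *
          (noAnswerProb D p i - noAnswerProb D p h) * (1 - noAnswerProb D p (i + 1)) ≤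
            ((j : ℝ) - i) * K := by
        calc _ = ((j : ℝ) - i) / firstAnswerProb D p (i + 1) *
              ((1 - noAnswerProb D p (i + 1)) * (noAnswerProb D p i - noAnswerProb D p h)) := by
              ring
          _ ≤ ((j : ℝ) - i) / firstAnswerProb D p (i + 1) * (K * firstAnswerProb D p (i + 1)) :=
              mul_le_mul_of_nonneg_left (hK i hlt) (div_nonneg hij' hlam.le)
          _ = ((j : ℝ) - i) * K := by field_simp
      linarith

end Growth

/-! ### Equilibrium and expected cost. -/

section Main

variable {d : ℕ} {D : PMF (Fin (d + 1))} {p : unitInterval} {h : ℕ}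

lemma utility_honest {r : ℕ → ℕ → ℝ} {u : Node d} (hu : u ≠ []) :
    utility D p h r (honest d h) u =
      ∑ l ∈ Finset.Icc 1 h, (∫ ω, passProb ω u l ∂(law D p)) * r u.length (l - u.length) := by
  rw [utility]
  simp_rw [selectionMean_payment_honest h _ r hu]
  rw [integral_finsetSum _ fun l _ => (integrable_passProb D p u l).mul_const _]
  exact Finset.sum_congr rfl fun l _ => integral_mul_const _ _

/-- Creating sybils does not pay for an agent without an answer. -/
lemma sum_sybil_le (hlam : ∀ l, 1 ≤ l → 0 < firstAnswerProb D p l) {P : ℕ → ℝ} {c : ℝ} {i k : ℕ}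
    (hi : 1 ≤ i) (hc : 0 ≤ c) (hP : ∀ l, i ≤ l → P l = c * firstAnswerProb D p l)
    (hk : i + k < h) :
    ∑ l ∈ Finset.Icc (i + 1) h, P l *
      (k + if l ≤ i + 1 then referral (firstAnswerProb D p) h (i + k) else 1) ≤
      ∑ l ∈ Finset.Icc (i + 1) h, P l * drReward D p h i (l - i) := by
  have hsplit : ∀ f : ℕ → ℝ, ∑ l ∈ Finset.Icc (i + 1) h, f l =
      f (i + 1) + ∑ l ∈ Finset.Icc (i + 2) h, f l := by
    intro f
    rw [← Finset.add_sum_Ioc_eq_sum_Icc (f := f) (by omega : i + 1 ≤ h),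
      ← Finset.Icc_add_one_left_eq_Ioc (i + 1)]
    rfl
  have h1 : ∀ l ∈ Finset.Icc (i + 2) h, P l *
      (k + if l ≤ i + 1 then referral (firstAnswerProb D p) h (i + k) else 1) =
        c * (k + 1) * firstAnswerProb D p l := by
    intro l hl
    rw [Finset.mem_Icc] at hl
    rw [if_neg (by omega), hP l (by omega)]
    ring
  have h2 : ∀ l ∈ Finset.Icc (i + 2) h, P l * drReward D p h i (l - i) =
      c * firstAnswerProb D p l := by
    intro l hl
    rw [Finset.mem_Icc] at hl
    rw [drReward_of_two_le (by omega) (by omega), hP l (by omega), mul_one]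
  rw [hsplit, hsplit, Finset.sum_congr rfl h1, Finset.sum_congr rfl h2, if_pos le_rfl,
    Nat.add_sub_cancel_left, drReward_one (by omega), hP (i + 1) (by omega), ← Finset.mul_sum,
    ← Finset.mul_sum]
  rcases Nat.eq_zero_or_pos k with rfl | hk0
  · simp
  -- The term `j = i + k` in the maximum defining `x_i`; times `c * λ_{i+1}` it is exactly the
  -- required inequality.
  · have h3 := le_referral (lam := firstAnswerProb D p) (by omega : i < i + k) hk.le
    have hpos := hlam (i + 1) (by omega)
    rw [hsplit] at h3
    set S := ∑ l ∈ Finset.Icc (i + 2) h, firstAnswerProb D p l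
    set x := referral (firstAnswerProb D p) h i
    set y := referral (firstAnswerProb D p) h (i + k)
    have h4 : (((i + k : ℕ) : ℝ) - i) / firstAnswerProb D p (i + 1) *
        (firstAnswerProb D p (i + 1) + S) * firstAnswerProb D p (i + 1) =
          k * (firstAnswerProb D p (i + 1) + S) := by
      push_cast
      field_simp
      ring
    have h5 := mul_le_mul_of_nonneg_left (mul_le_mul_of_nonneg_right h3 hpos.le) hc
    rw [add_mul, h4] at h5
    linarith

lemma utility_deviation_le (hd : 0 < d) (hlam : ∀ l, 1 ≤ l → 0 < firstAnswerProb D p l)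
    {u : Node d} (hu : u ≠ []) (τ : Strategy d) :
    utility D p h (drReward D p h) (Function.update (honest d h) u τ) u ≤
      utility D p h (drReward D p h) (honest d h) u := by
  have hu1 : 1 ≤ u.length := List.length_pos_iff.2 hu
  have hr : ∀ j s, 1 ≤ j → 0 ≤ drReward D p h j s := fun j s hj => drReward_nonneg hlam s hj
  set i := u.length with hi
  set k := (τ u.length false).attach.length with hk
  set P : ℕ → ℝ := fun l => ∫ ω, passProb ω u l ∂(law D p) with hP
  have hP0 : ∀ l, 0 ≤ P l := fun l => integral_nonneg fun ω => passProb_nonneg ω u l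
  have hPl : ∀ l, i ≤ l → P l = ((d : ℝ) ^ i)⁻¹ * firstAnswerProb D p l := by
    intro l hl
    rw [← integral_passProb D p u (hu1.trans hl) hl, ← hi, inv_mul_cancel_left₀ (by positivity)]
  rw [utility_honest hu]
  have hnn : 0 ≤ ∑ l ∈ Finset.Icc 1 h, P l * drReward D p h i (l - i) :=
    Finset.sum_nonneg fun l _ => mul_nonneg (hP0 l) (hr _ _ hu1)
  -- With `i + k ≥ h`, every answer from below arrives beyond the height and earns nothing.
  set B : ℕ → ℝ := fun l => if i + k < h then
    k + if l ≤ i + 1 then referral (firstAnswerProb D p) h (i + k) else 1 else 0 with hB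
  have hB0 : ∀ l, 0 ≤ B l := by
    intro l
    simp only [hB]
    have := referral_nonneg (h := h) hlam (i + k)
    split_ifs <;> positivity
  have hpt : ∀ ω, selectionMean (reported (Function.update (honest d h) u τ) ω h)
      (payment (Function.update (honest d h) u τ) ω (drReward D p h) u) ≤
        passProb ω u i * drReward D p h i 0 +
          ∑ l ∈ Finset.Icc (i + 1) h, passProb ω u l * B l := by
    intro ω
    cases hans : (ω u).2 with
    | true =>
      refine (deviation_le_of_answer hu τ hr hans (hr i 0 hu1) fun m him hm =>
        sum_drReward_le_drReward_zero hlam him hm).trans (le_add_of_nonneg_right ?_)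
      exact Finset.sum_nonneg fun l _ => mul_nonneg (passProb_nonneg _ _ _) (hB0 l)
    | false =>
      refine (deviation_le_of_no_answer hu τ hr hans rfl hB0 fun s l hs hks _ hl => ?_).trans
        (le_add_of_nonneg_left (mul_nonneg (passProb_nonneg _ _ _) (hr i 0 hu1)))
      simp only [hB]
      rw [if_pos (by omega)]
      exact sum_drReward_sybils_le hlam hs hks hl
  have hint : Integrable (fun ω => passProb ω u i * drReward D p h i 0 +
      ∑ l ∈ Finset.Icc (i + 1) h, passProb ω u l * B l) (law D p) :=
    ((integrable_passProb D p u i).mul_const _).add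
      (integrable_finsetSum _ fun l _ => (integrable_passProb D p u l).mul_const _)
  rw [utility]
  -- If the integrand were not integrable, its integral would be `0` by convention, which the
  -- nonnegative honest utility beats.
  by_cases hdev : Integrable (fun ω => selectionMean
      (reported (Function.update (honest d h) u τ) ω h)
      (payment (Function.update (honest d h) u τ) ω (drReward D p h) u)) (law D p)
  · refine (integral_mono hdev hint hpt).trans ?_
    rw [integral_add ((integrable_passProb D p u i).mul_const _)
      (integrable_finsetSum _ fun l _ => (integrable_passProb D p u l).mul_const _),
      integral_mul_const, integral_finsetSum _ fun l _ => (integrable_passProb D p u l).mul_const _]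
    simp_rw [integral_mul_const]
    change P i * drReward D p h i 0 + ∑ l ∈ Finset.Icc (i + 1) h, P l * B l ≤
      ∑ l ∈ Finset.Icc 1 h, P l * drReward D p h i (l - i)
    rcases lt_or_ge h i with hhi | hih
    · rw [Finset.Icc_eq_empty (by omega), Finset.sum_empty, drReward, if_neg (by omega), mul_zero,
        zero_add]
      exact hnn
    · have hB' : ∑ l ∈ Finset.Icc (i + 1) h, P l * B l ≤
          ∑ l ∈ Finset.Icc (i + 1) h, P l * drReward D p h i (l - i) := by
        by_cases hkh : i + k < h
        · simp only [hB, if_pos hkh]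
          exact sum_sybil_le hlam hu1 (by positivity) hPl hkh
        · simp only [hB, if_neg hkh, mul_zero, Finset.sum_const_zero]
          exact Finset.sum_nonneg fun l _ => mul_nonneg (hP0 l) (hr _ _ hu1)
      calc P i * drReward D p h i 0 + ∑ l ∈ Finset.Icc (i + 1) h, P l * B l
          ≤ P i * drReward D p h i (i - i) +
            ∑ l ∈ Finset.Icc (i + 1) h, P l * drReward D p h i (l - i) := by
            rw [Nat.sub_self]
            exact add_le_add le_rfl hB'
        _ = ∑ l ∈ Finset.Icc i h, P l * drReward D p h i (l - i) := by
            rw [Finset.Icc_add_one_left_eq_Ioc, Finset.add_sum_Ioc_eq_sum_Icc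
              (f := fun l => P l * drReward D p h i (l - i)) hih]
        _ ≤ _ := Finset.sum_le_sum_of_subset_of_nonneg (Finset.Icc_subset_Icc_left hu1)
            fun l _ _ => mul_nonneg (hP0 l) (hr _ _ hu1)
  · rw [integral_undef hdev]
    exact hnn

lemma expectedCost_eq (r : ℕ → ℕ → ℝ) :
    expectedCost D p h r = ∑ l ∈ Finset.Icc 1 h,
      firstAnswerProb D p l * ∑ j ∈ Finset.Icc 1 l, r j (l - j) := by
  have hind : ∀ l, (fun ω : Env d => if FirstAt ω l then (1 : ℝ) else 0) =
      {ω | FirstAt ω l}.indicator 1 := fun l => by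
    ext ω
    rw [Set.indicator_apply]
    rfl
  have hint : ∀ l, Integrable (fun ω : Env d => if FirstAt ω l then (1 : ℝ) else 0) (law D p) :=
    fun l => by
      rw [hind]
      exact (integrable_const (1 : ℝ)).indicator (measurableSet_firstAt l)
  rw [expectedCost]
  simp_rw [selectionMean_totalPayment_honest]
  rw [integral_finsetSum _ fun l _ => (hint l).mul_const _]
  refine Finset.sum_congr rfl fun l hl => ?_
  rw [integral_mul_const, hind, integral_indicator_one (measurableSet_firstAt l),
    firstAnswerProb_eq D p (Finset.mem_Icc.1 hl).1]

lemma expectedCost_le (hb : 1 < branchingFactor D) (hp0 : 0 < (p : ℝ)) (hp1 : (p : ℝ) < 1)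
    {K : ℝ} (hK0 : 0 ≤ K) (hK : ∀ i, i < h →
      (1 - noAnswerProb D p (i + 1)) * (noAnswerProb D p i - noAnswerProb D p h) ≤
        K * firstAnswerProb D p (i + 1)) (hh : 1 ≤ h) :
    expectedCost D p h (drReward D p h) ≤ (1 + K) * (h : ℝ) ^ 2 := by
  have hlam := firstAnswerProb_pos hb hp0 hp1
  have hlam0 : ∀ l ∈ Finset.Icc 1 h, 0 ≤ firstAnswerProb D p l := fun l hl =>
    (hlam l (Finset.mem_Icc.1 hl).1).le
  have hsum : ∀ m, ∑ l ∈ Finset.Icc 1 m, firstAnswerProb D p l = 1 - noAnswerProb D p m := by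
    intro m
    rw [← noAnswerProb_zero D p]
    exact sum_firstAnswerProb (Nat.zero_le m)
  have h1 : (1 : ℝ) ≤ h := by exact_mod_cast hh
  rw [expectedCost_eq]
  calc ∑ l ∈ Finset.Icc 1 h, firstAnswerProb D p l *
        ∑ j ∈ Finset.Icc 1 l, drReward D p h j (l - j)
      ≤ ∑ l ∈ Finset.Icc 1 h, firstAnswerProb D p l *
        (h + ∑ j ∈ Finset.Icc (max 1 (l - 1)) h, referral (firstAnswerProb D p) h j) := by
        refine Finset.sum_le_sum fun l hl => mul_le_mul_of_nonneg_left ?_ (hlam0 l hl)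
        rw [Finset.mem_Icc] at hl
        refine (sum_drReward_le hl.1 hl.2).trans ?_
        push_cast
        linarith
    _ = h * ∑ l ∈ Finset.Icc 1 h, firstAnswerProb D p l + ∑ l ∈ Finset.Icc 1 h,
          ∑ j ∈ Finset.Icc (max 1 (l - 1)) h,
            firstAnswerProb D p l * referral (firstAnswerProb D p) h j := by
        simp_rw [mul_add, Finset.sum_add_distrib, Finset.mul_sum, mul_comm (h : ℝ)]
    _ ≤ h * 1 + ∑ j ∈ Finset.Icc 1 h, K * h := by
        refine add_le_add (mul_le_mul_of_nonneg_left ?_ (by linarith)) ?_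
        · rw [hsum]
          linarith [noAnswerProb_nonneg (D := D) (p := p) h]
        -- Exchanging the sums, `x_j` is charged exactly for `l ≤ j + 1`, so its weight is at most
        -- `1 - noAnswerProb D p (j + 1)`, the factor in `referral_mul_le`.
        · rw [Finset.sum_comm' (t' := Finset.Icc 1 h)
            (s' := fun j => (Finset.Icc 1 h).filter fun l => l ≤ j + 1)]
          · refine Finset.sum_le_sum fun j hj => ?_
            rw [Finset.mem_Icc] at hj
            have h2 := referral_mul_le hb hp0 hp1 hK hj.2
            have h3 : ∑ l ∈ (Finset.Icc 1 h).filter (fun l => l ≤ j + 1), firstAnswerProb D p l ≤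
                1 - noAnswerProb D p (j + 1) := by
              rw [← hsum]
              refine Finset.sum_le_sum_of_subset_of_nonneg (fun l hl => ?_) fun l hl _ =>
                (hlam l (Finset.mem_Icc.1 hl).1).le
              rw [Finset.mem_filter, Finset.mem_Icc] at hl
              exact Finset.mem_Icc.2 ⟨hl.1.1, hl.2⟩
            rw [← Finset.sum_mul, mul_comm]
            refine (mul_le_mul_of_nonneg_left h3 (referral_nonneg hlam j)).trans (h2.trans ?_)
            have h4 : (0 : ℝ) ≤ j := Nat.cast_nonneg j
            nlinarith
          · intro l j
            simp only [Finset.mem_Icc, Finset.mem_filter]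
            omega
    _ ≤ (1 + K) * (h : ℝ) ^ 2 := by
        rw [Finset.sum_const, Nat.card_Icc, Nat.add_sub_cancel, nsmul_eq_mul]
        nlinarith

end Main

end QueryIncentive

end

theorem theorem2 (d : ℕ) (D : PMF (Fin (d + 1))) (hb : 1 < QueryIncentive.branchingFactor D) :
    ∃ p_b : ℝ, 0 < p_b ∧ ∃ C : ℝ,
      ∀ (n : ℝ) (p : unitInterval), (p : ℝ) = 1 / n → 0 < 1 / n → 1 / n < p_b →
        ∀ h : ℕ, 1 ≤ h →
          QueryIncentive.IsDirectReferral h (QueryIncentive.drReward D p h) ∧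
          QueryIncentive.SybilProof D p h (QueryIncentive.drReward D p h) ∧
          QueryIncentive.expectedCost D p h (QueryIncentive.drReward D p h) ≤ C * (h : ℝ) ^ 2 := by
  obtain ⟨K, hK0, hK⟩ := QueryIncentive.exists_growth_bound hb
  -- The bound `1 / 2` keeps `1 - p` away from `0`, so that `K` depends on `D` alone. In `1 + K`,
  -- the `1` covers the unit rewards and `K` the referral rewards.
  refine ⟨1 / 2, by norm_num, 1 + K, fun n p hpn hp0 hp1 h hh => ?_⟩
  rw [← hpn] at hp0 hp1
  have hlt : (p : ℝ) < 1 := by linarith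
  have hd : 0 < d := by
    obtain ⟨j, hj, -⟩ := QueryIncentive.exists_two_le hb
    omega
  have hlam := QueryIncentive.firstAnswerProb_pos hb hp0 hlt
  exact ⟨QueryIncentive.isDirectReferral_drReward hlam,
    fun u hu τ => QueryIncentive.utility_deviation_le hd hlam hu τ,
    QueryIncentive.expectedCost_le hb hp0 hlt hK0 (fun i hi => hK p hp0 hp1 i h hi) hh⟩
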